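/- Let $n\ge 1$, $\mu>0$, and let $U,W:\mathbb R^n\to\mathbb R$ be (essentially) bounded measurable functions that tend to zero at infinity. Put $H=\frac12\Delta-\mu$ and let $$A=\begin{pmatrix} H+U & -W\\ W & -H-U\end{pmatrix}$$ act as an unbounded operator on $L^2(\mathbb R^n)\times L^2(\mathbb R^n)$ (complex-valued functions) with domain $H^2(\mathbb R^n)\times H^2(\mathbb R^n)$. Let $\Omega=\mathbb C\setminus\big((-\infty,-\mu]\cup[\mu,\infty)\big)$. Then: 1. The spectrum of $A$ has no accumulation point in $\Omega$, and the resolvent $z\mapsto (A-z)^{-1}$ is a meromorphic function on $\Omega$ with values in the bounded operators. 2. For $z\in\Omega$ the following are equivalent: $z$ is a pole of the resolvent; $z$ belongs to the spectrum of $A$; $z$ is an eigenvalue of $A$. These eigenvalues have finite algebraic (hence finite geometric) multiplicity, i.e. $\bigcup_{k\ge1}\ker (A-z)^k$ is finite-dimensional for every $z\in\Omega$. 3. $\operatorname{Ran}(A-z)$ is closed for every $z\in\Omega$. 4. The essential spectrum of $A$ is $\operatorname{spec}_{\rm ess}(A)=(-\infty,-\mu]\cup[\mu,\infty)$. Here the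 essential spectrum is the set of all points of the spectrum that do not belong to the discrete spectrum, and the discrete spectrum consists of the isolated points $\lambda$ of the spectrum for which the Riesz projection $-\frac1{2\pi i}\oint_{|z-\lambda|=r}(A-z)^{-1}\,dz$ ($r>0$ small) has finite rank. -/

import Mathlib

open MeasureTheory Filter Topology
open scoped ENNReal SchwartzMap Laplacian

noncomputable section

/-! ### Spectral notions for unbounded operators on a complex Banach space -/

namespace UnboundedOp

variable {X : Type*} [NormedAddCommGroup X] [NormedSpace ℂ X]

/-- The operator `A - z`, as a linear map on the domain of `A`. -/
def shift (A : X →ₗ.[ℂ] X) (z : ℂ) : A.domain →ₗ[ℂ] X :=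
  A.toFun - z • A.domain.subtype

/-- `R` is a bounded two-sided inverse of `A - z : Dom(A) → X`. -/
def IsResolventAt (A : X →ₗ.[ℂ] X) (z : ℂ) (R : X →L[ℂ] X) : Prop :=
  (∀ f : X, ∃ h : R f ∈ A.domain, shift A z ⟨R f, h⟩ = f) ∧
    ∀ f : A.domain, R (shift A z f) = f

/-- The resolvent set of `A`. -/
def resolventSet (A : X →ₗ.[ℂ] X) : Set ℂ :=
  {z | ∃ R : X →L[ℂ] X, IsResolventAt A z R}

/-- The spectrum of `A`. -/
def spectrum (A : X →ₗ.[ℂ] X) : Set ℂ := (resolventSet A)ᶜ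

open Classical in
/-- The resolvent `(A - z)⁻¹`, as a bounded operator on `X`
(with the value `0` off the resolvent set). -/
def resolvent (A : X →ₗ.[ℂ] X) (z : ℂ) : X →L[ℂ] X :=
  if h : ∃ R : X →L[ℂ] X, IsResolventAt A z R then h.choose else 0

theorem IsResolventAt.unique {A : X →ₗ.[ℂ] X} {z : ℂ} {R S : X →L[ℂ] X}
    (hR : IsResolventAt A z R) (hS : IsResolventAt A z S) : R = S := by
  ext f
  obtain ⟨h, hf⟩ := hS.1 f
  have := hR.2 ⟨S f, h⟩
  rwa [hf] at this

theorem isResolventAt_resolvent {A : X →ₗ.[ℂ] X} {z : ℂ} (hz : z ∈ resolventSet A) :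
    IsResolventAt A z (resolvent A z) := by
  have h : ∃ R : X →L[ℂ] X, IsResolventAt A z R := hz
  rw [resolvent, dif_pos h]
  exact h.choose_spec

/-- `z` is an eigenvalue of `A`. -/
def IsEigenvalue (A : X →ₗ.[ℂ] X) (z : ℂ) : Prop :=
  ∃ f : A.domain, f ≠ 0 ∧ A f = z • (f : X)

/-- The kernel of `(A - z) ^ k`, on its natural domain. -/
def kerPow (A : X →ₗ.[ℂ] X) (z : ℂ) : ℕ → Submodule ℂ X
  | 0 => ⊥
  | k + 1 => ((kerPow A z k).comap (shift A z)).map A.domain.subtype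

/-- The root space `⋃ k, ker ((A - z) ^ k)`; its dimension is the algebraic multiplicity of `z`
(and the geometric multiplicity is at most that). -/
def rootSpace (A : X →ₗ.[ℂ] X) (z : ℂ) : Submodule ℂ X := ⨆ k, kerPow A z k

/-- The Riesz operator `-(2πi)⁻¹ ∮_{|w - z| = r} (A - w)⁻¹ dw`. -/
def rieszProjection (A : X →ₗ.[ℂ] X) (z : ℂ) (r : ℝ) : X →L[ℂ] X :=
  -(2 * (Real.pi : ℂ) * Complex.I)⁻¹ • ∮ w in C(z, r), resolvent A w

/-- The discrete spectrum: isolated points of the spectrum whose spectral projection has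
finite rank. -/
def discreteSpectrum (A : X →ₗ.[ℂ] X) : Set ℂ :=
  {z | z ∈ spectrum A ∧ ∃ r > 0, Metric.closedBall z r ∩ spectrum A = {z} ∧
    FiniteDimensional ℂ (rieszProjection A z r).range}

/-- The essential spectrum: the complement in the spectrum of the discrete spectrum. -/
def essentialSpectrum (A : X →ₗ.[ℂ] X) : Set ℂ := spectrum A \ discreteSpectrum A

end UnboundedOp

/-! ### The matrix Hamiltonian -/

/-- The complex Hilbert space `L²(ℝⁿ)`. -/
abbrev L2 (n : ℕ) : Type := Lp ℂ 2 (volume : Measure (EuclideanSpace ℝ (Fin n)))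

/-- The Sobolev space `H²(ℝⁿ)`, as a subspace of `L²(ℝⁿ)`. -/
def sobolevH2 (n : ℕ) : Submodule ℂ (L2 n) where
  carrier := {f | TemperedDistribution.MemSobolev 2 2 (f : 𝓢'(EuclideanSpace ℝ (Fin n), ℂ))}
  add_mem' {f g} hf hg := by
    have h := TemperedDistribution.MemSobolev.add hf hg
    simpa only [Set.mem_ofPred_eq, ← Lp.toTemperedDistributionCLM_apply, map_add] using h
  zero_mem' := by
    have h := TemperedDistribution.memSobolev_fun_zero (EuclideanSpace ℝ (Fin n)) ℂ 2 2
    simpa only [Set.mem_ofPred_eq, ← Lp.toTemperedDistributionCLM_apply, map_zero] using h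
  smul_mem' c f hf := by
    have h := TemperedDistribution.MemSobolev.smul c hf
    simpa only [Set.mem_ofPred_eq, ← Lp.toTemperedDistributionCLM_apply, map_smul] using h

theorem L2.toTemperedDistribution_injective (n : ℕ) :
    Function.Injective
      (Lp.toTemperedDistributionCLM ℂ (volume : Measure (EuclideanSpace ℝ (Fin n))) 2) :=
  LinearMap.ker_eq_bot.mp Lp.ker_toTemperedDistributionCLM_eq_bot

theorem exists_laplacian_L2 {n : ℕ} (f : sobolevH2 n) :
    ∃ g : L2 n, (g : 𝓢'(EuclideanSpace ℝ (Fin n), ℂ)) =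
      Δ ((f : L2 n) : 𝓢'(EuclideanSpace ℝ (Fin n), ℂ)) := by
  have h := TemperedDistribution.MemSobolev.laplacian f.2
  rw [sub_self, TemperedDistribution.memSobolev_zero_iff] at h
  obtain ⟨g, hg⟩ := h
  exact ⟨g, hg.symm⟩

/-- The Laplacian `Δ : H²(ℝⁿ) → L²(ℝⁿ)`: the `L²` function that represents the distributional
Laplacian. -/
def laplacianH2 (n : ℕ) : sobolevH2 n →ₗ[ℂ] L2 n where
  toFun f := (exists_laplacian_L2 f).choose
  map_add' f g := by
    apply L2.toTemperedDistribution_injective n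
    simp only [map_add, Lp.toTemperedDistributionCLM_apply]
    rw [(exists_laplacian_L2 (f + g)).choose_spec, (exists_laplacian_L2 f).choose_spec,
      (exists_laplacian_L2 g).choose_spec]
    simp only [← Lp.toTemperedDistributionCLM_apply, Submodule.coe_add, map_add,
      ← TemperedDistribution.laplacianCLM_apply]
  map_smul' c f := by
    apply L2.toTemperedDistribution_injective n
    simp only [map_smul, Lp.toTemperedDistributionCLM_apply, RingHom.id_apply]
    rw [(exists_laplacian_L2 (c • f)).choose_spec, (exists_laplacian_L2 f).choose_spec]
    simp only [← Lp.toTemperedDistributionCLM_apply, Submodule.coe_smul, map_smul,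
      ← TemperedDistribution.laplacianCLM_apply]

theorem laplacianH2_spec {n : ℕ} (f : sobolevH2 n) :
    (laplacianH2 n f : 𝓢'(EuclideanSpace ℝ (Fin n), ℂ)) =
      Δ ((f : L2 n) : 𝓢'(EuclideanSpace ℝ (Fin n), ℂ)) :=
  (exists_laplacian_L2 f).choose_spec

theorem memLp_mul_L2 {n : ℕ} {U : EuclideanSpace ℝ (Fin n) → ℝ} (hU : MemLp U ∞ volume)
    (f : L2 n) : MemLp (fun x => (U x : ℂ) * f x) 2 volume :=
  (Lp.memLp f).mul (hU.ofReal (K := ℂ))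

/-- Multiplication by the real potential `U ∈ L^∞(ℝⁿ)` on `L²(ℝⁿ)`. -/
def mulL2 {n : ℕ} (U : EuclideanSpace ℝ (Fin n) → ℝ) (hU : MemLp U ∞ volume) :
    L2 n →ₗ[ℂ] L2 n where
  toFun f := (memLp_mul_L2 hU f).toLp (fun x => (U x : ℂ) * f x)
  map_add' f g := by
    rw [← MemLp.toLp_add]
    apply MemLp.toLp_congr
    filter_upwards [Lp.coeFn_add f g] with x hx
    rw [hx, Pi.add_apply, Pi.add_apply, mul_add]
  map_smul' c f := by
    rw [RingHom.id_apply, ← MemLp.toLp_const_smul]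
    apply MemLp.toLp_congr
    filter_upwards [Lp.coeFn_smul c f] with x hx
    simp [hx, mul_left_comm]

/-- The scalar operator `H = ½Δ - μ : H²(ℝⁿ) → L²(ℝⁿ)`. -/
def scalarH (n : ℕ) (μ : ℝ) : sobolevH2 n →ₗ[ℂ] L2 n :=
  (1 / 2 : ℂ) • laplacianH2 n - (μ : ℂ) • (sobolevH2 n).subtype

/-- The matrix Hamiltonian
`A (f₁, f₂) = ((H + U) f₁ - W f₂, W f₁ - (H + U) f₂)` with `H = ½Δ - μ`,
as an unbounded operator on `L²(ℝⁿ) × L²(ℝⁿ)` with domain `H²(ℝⁿ) × H²(ℝⁿ)`.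
(The product carries the maximum norm, which is equivalent to its Hilbert norm; every notion used
below depends only on the topology.) -/
def matrixHamiltonian (n : ℕ) (μ : ℝ) (U W : EuclideanSpace ℝ (Fin n) → ℝ)
    (hU : MemLp U ∞ volume) (hW : MemLp W ∞ volume) :
    (L2 n × L2 n) →ₗ.[ℂ] (L2 n × L2 n) where
  domain := (sobolevH2 n).prod (sobolevH2 n)
  toFun :=
    let p₁ : (sobolevH2 n).prod (sobolevH2 n) →ₗ[ℂ] sobolevH2 n :=
      ((LinearMap.fst ℂ (L2 n) (L2 n)).comp
        ((sobolevH2 n).prod (sobolevH2 n)).subtype).codRestrict _ fun f => f.2.1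
    let p₂ : (sobolevH2 n).prod (sobolevH2 n) →ₗ[ℂ] sobolevH2 n :=
      ((LinearMap.snd ℂ (L2 n) (L2 n)).comp
        ((sobolevH2 n).prod (sobolevH2 n)).subtype).codRestrict _ fun f => f.2.2
    let HU : sobolevH2 n →ₗ[ℂ] L2 n := scalarH n μ + mulL2 U hU ∘ₗ (sobolevH2 n).subtype
    let W' : sobolevH2 n →ₗ[ℂ] L2 n := mulL2 W hW ∘ₗ (sobolevH2 n).subtype
    (HU ∘ₗ p₁ - W' ∘ₗ p₂).prod (W' ∘ₗ p₁ - HU ∘ₗ p₂)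

theorem matrixHamiltonian_apply {n : ℕ} {μ : ℝ} {U W : EuclideanSpace ℝ (Fin n) → ℝ}
    (hU : MemLp U ∞ volume) (hW : MemLp W ∞ volume) (f₁ f₂ : sobolevH2 n) :
    matrixHamiltonian n μ U W hU hW ⟨((f₁ : L2 n), (f₂ : L2 n)), ⟨f₁.2, f₂.2⟩⟩ =
      ((1 / 2 : ℂ) • laplacianH2 n f₁ - (μ : ℂ) • (f₁ : L2 n) + mulL2 U hU f₁ - mulL2 W hW f₂,
        mulL2 W hW f₁
          - ((1 / 2 : ℂ) • laplacianH2 n f₂ - (μ : ℂ) • (f₂ : L2 n) + mulL2 U hU f₂)) :=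
  rfl

/-- The set `(-∞, -μ] ∪ [μ, ∞)` of real numbers, as a subset of the complex plane. -/
def spectralRays (μ : ℝ) : Set ℂ := (fun t : ℝ => (t : ℂ)) '' (Set.Iic (-μ) ∪ Set.Ici μ)

end

/-! Write A = A₀ + V with A₀ = diag(H, -H) and V the bounded potential matrix. On the Fourier side
A₀ is multiplication by real symbols, so off the two rays its resolvent is explicit, with norm at
most 1/|Im z| for nonreal z. Taking Im z₀ = ‖V‖ + 1 and S = (A₀ - z₀)⁻¹ makes 1 + VS invertible, and
T = S(1 + VS)⁻¹ is the resolvent of A at z₀ (`exists_isResolventAt_matrixHamiltonian`).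

Questions about A - w then pass to the bounded pencil L_T(w) = 1 - (w - z₀)T = (A - w)T. It differs
from L_S(w) by (w - z₀)K with K = TVS. Here K is a norm limit of finite-rank operators, because VS
is built from functions vanishing at infinity in x composed with multipliers vanishing at infinity
in ξ (`mulCLM_comp_fourierMultiplier_mem`). Off the rays L_S(w) is invertible, so L_T(w) is
invertible plus finite rank.

Such operators have closed range and finite-dimensional kernel, and a finite determinant decides
their invertibility. Hence injective implies invertible, and `analyticFredholm` applies on the
star-shaped set Ω, where L_T(z₀) = 1. If (w - z)^m L_T(w)⁻¹ is regular at z, then ker L_T(z)^m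
contains both the root space and the range of the Riesz projection (`ker_pencil_pow_le`,
`IsResolventAt.range_rieszProjection_le`); so the spectrum in Ω is discrete.

On the rays A₀ has approximate eigenvectors but no eigenvectors. If L_T(z) were invertible there,
L_S(z) would be invertible plus finite rank and injective, hence invertible, which is false. So the
rays lie in the spectrum of A, and none of their points is isolated. -/

noncomputable section

open scoped FourierTransform RealInnerProductSpace

/-! ### Finite-rank operators and their norm limits -/

section FiniteRank

variable {X Y Z : Type*} [NormedAddCommGroup X] [NormedSpace ℂ X] [NormedAddCommGroup Y]
  [NormedSpace ℂ Y] [NormedAddCommGroup Z] [NormedSpace ℂ Z]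

/-- The bounded operators of finite rank. -/
def finiteRankOperators (X Y : Type*) [NormedAddCommGroup X] [NormedSpace ℂ X]
    [NormedAddCommGroup Y] [NormedSpace ℂ Y] : Submodule ℂ (X →L[ℂ] Y) where
  carrier := {F | (F : X →ₗ[ℂ] Y).HasFiniteRange}
  add_mem' hF hG := by
    simpa only [Set.mem_ofPred_eq, ContinuousLinearMap.toLinearMap_add] using
      LinearMap.HasFiniteRange.add hF hG
  zero_mem' := by simp
  smul_mem' c F hF := by
    simpa only [Set.mem_ofPred_eq, ContinuousLinearMap.toLinearMap_smul] using
      LinearMap.HasFiniteRange.smul hF c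

/-- The norm closure of the bounded operators of finite rank. -/
def approximableOperators (X Y : Type*) [NormedAddCommGroup X] [NormedSpace ℂ X]
    [NormedAddCommGroup Y] [NormedSpace ℂ Y] : Submodule ℂ (X →L[ℂ] Y) :=
  (finiteRankOperators X Y).topologicalClosure

theorem mem_finiteRankOperators {F : X →L[ℂ] Y} :
    F ∈ finiteRankOperators X Y ↔ (F : X →ₗ[ℂ] Y).HasFiniteRange := Iff.rfl

theorem finiteRankOperators_le_approximableOperators :
    finiteRankOperators X Y ≤ approximableOperators X Y :=
  Submodule.le_topologicalClosure _

theorem isClosed_approximableOperators :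
    IsClosed (approximableOperators X Y : Set (X →L[ℂ] Y)) :=
  Submodule.isClosed_topologicalClosure _

theorem comp_mem_finiteRankOperators_left (B : Y →L[ℂ] Z) {F : X →L[ℂ] Y}
    (hF : F ∈ finiteRankOperators X Y) : B ∘L F ∈ finiteRankOperators X Z :=
  LinearMap.HasFiniteRange.comp_left hF (B : Y →ₗ[ℂ] Z)

theorem comp_mem_finiteRankOperators_right {F : Y →L[ℂ] Z} (hF : F ∈ finiteRankOperators Y Z)
    (B : X →L[ℂ] Y) : F ∘L B ∈ finiteRankOperators X Z :=
  LinearMap.HasFiniteRange.comp_right hF (B : X →ₗ[ℂ] Y)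

theorem comp_mem_approximableOperators_left (B : Y →L[ℂ] Z) {K : X →L[ℂ] Y}
    (hK : K ∈ approximableOperators X Y) : B ∘L K ∈ approximableOperators X Z :=
  map_mem_closure ((ContinuousLinearMap.compL ℂ X Y Z B).continuous) hK
    fun _ hF => comp_mem_finiteRankOperators_left B hF

theorem comp_mem_approximableOperators_right {K : Y →L[ℂ] Z}
    (hK : K ∈ approximableOperators Y Z) (B : X →L[ℂ] Y) :
    K ∘L B ∈ approximableOperators X Z :=
  map_mem_closure (f := fun K : Y →L[ℂ] Z => K ∘L B)
    (((ContinuousLinearMap.compL ℂ X Y Z).flip B).continuous) hK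
    fun _ hF => comp_mem_finiteRankOperators_right hF B

theorem exists_eq_sum_of_mem_finiteRankOperators {F : X →L[ℂ] Y}
    (hF : F ∈ finiteRankOperators X Y) :
    ∃ (m : ℕ) (φ : Fin m → X →L[ℂ] ℂ) (y : Fin m → Y), ∀ x, F x = ∑ i, φ i x • y i := by
  have : FiniteDimensional ℂ F.range := Module.Finite.of_fg hF
  let b := Module.finBasis ℂ F.range
  refine ⟨_, fun i => (LinearMap.toContinuousLinearMap (b.coord i)) ∘L
    (F.codRestrict F.range fun x => ⟨x, rfl⟩), fun i => b i, fun x => ?_⟩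
  have := congrArg Subtype.val (b.sum_repr ⟨F x, ⟨x, rfl⟩⟩)
  simp only [AddSubmonoidClass.coe_finsetSum, SetLike.val_smul] at this
  exact this.symm

end FiniteRank

/-! ### Finite-rank perturbations of an invertible operator -/

section Perturbation

variable {X : Type*} [NormedAddCommGroup X] [NormedSpace ℂ X] {m : ℕ}

/-- The matrix `1 + (φᵢ (D yⱼ))`, whose determinant decides whether the perturbation
`D⁻¹ + ∑ᵢ φᵢ(·) yᵢ` is invertible. -/
def perturbationMatrix (D : X →L[ℂ] X) (φ : Fin m → X →L[ℂ] ℂ) (y : Fin m → X) :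
    Matrix (Fin m) (Fin m) ℂ :=
  1 + Matrix.of fun i j => φ i (D (y j))

/-- The inverse of `D⁻¹ + ∑ᵢ φᵢ(·) yᵢ`, provided that the perturbation matrix is invertible. -/
def perturbationInverse (D : X →L[ℂ] X) (φ : Fin m → X →L[ℂ] ℂ) (y : Fin m → X) :
    X →L[ℂ] X :=
  D - ∑ i, ∑ j, ((perturbationMatrix D φ y).det⁻¹ * (perturbationMatrix D φ y).adjugate i j) •
    ((φ j ∘L D).smulRight (D (y i)))

variable {D G L : X →L[ℂ] X} {φ : Fin m → X →L[ℂ] ℂ} {y : Fin m → X}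

/-- This is the Woodbury formula: L maps D yᵢ to ∑ₖ Mₖᵢ yₖ, so the inverse matrix of M supplies the
coefficients that cancel the error ∑ⱼ φⱼ(D f) yⱼ in L D f. -/
theorem mul_perturbationInverse (hGD : G * D = 1) (hL : ∀ x, L x = G x + ∑ i, φ i x • y i)
    (hdet : (perturbationMatrix D φ y).det ≠ 0) : L * perturbationInverse D φ y = 1 := by
  have hG : ∀ x, G (D x) = x := fun x => congrArg (fun B : X →L[ℂ] X => B x) hGD
  set M := perturbationMatrix D φ y with hM
  have hLD : ∀ i, L (D (y i)) = ∑ k, M k i • y k := by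
    intro i
    rw [hL, hG]
    simp [hM, perturbationMatrix, Matrix.one_apply, add_smul, Finset.sum_add_distrib]
  have hinv : ∀ k j, ∑ i, M k i * (M.det⁻¹ * M.adjugate i j) = (1 : Matrix _ _ ℂ) k j := by
    intro k j
    have := congrFun (congrFun M.mul_adjugate k) j
    rw [Matrix.mul_apply] at this
    simp only [mul_left_comm _ M.det⁻¹, ← Finset.mul_sum, this]
    simp [hdet]
  ext f
  have : ∑ i, ∑ j, (M.det⁻¹ * M.adjugate i j) • (φ j (D f) • ∑ k, M k i • y k) =
      ∑ j, φ j (D f) • y j := by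
    simp only [Finset.smul_sum, smul_smul]
    calc _ = ∑ j, ∑ k, (∑ i, M k i * (M.det⁻¹ * M.adjugate i j)) • φ j (D f) • y k := by
          rw [Finset.sum_comm]
          refine Finset.sum_congr rfl fun j _ => ?_
          rw [Finset.sum_comm]
          refine Finset.sum_congr rfl fun k _ => ?_
          rw [Finset.sum_smul]
          refine Finset.sum_congr rfl fun i _ => ?_
          rw [smul_smul]
          ring_nf
      _ = _ := by
          simp only [hinv, Matrix.one_apply, ite_smul, one_smul, zero_smul]
          simp
  simp only [perturbationInverse, mul_apply_eq_comp, sub_apply,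
    sum_apply, smul_apply,
    ContinuousLinearMap.smulRight_apply, ContinuousLinearMap.comp_apply, map_sub, map_sum,
    map_smul, hLD]
  rw [← hM, this, hL, hG]
  simp

/-- A kernel vector x satisfies x = -D(∑ cⱼ yⱼ) with cⱼ = φⱼ(x), and then Mc = 0; conversely a null
vector of M produces a kernel vector by the same formula. -/
theorem injective_iff_det_perturbationMatrix_ne_zero (hGD : G * D = 1) (hDG : D * G = 1)
    (hL : ∀ x, L x = G x + ∑ i, φ i x • y i) :
    Function.Injective L ↔ (perturbationMatrix D φ y).det ≠ 0 := by
  have hG : ∀ x, G (D x) = x := fun x => congrArg (fun B : X →L[ℂ] X => B x) hGD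
  have hD : ∀ x, D (G x) = x := fun x => congrArg (fun B : X →L[ℂ] X => B x) hDG
  have hmul : ∀ (c : Fin m → ℂ) i, ((perturbationMatrix D φ y).mulVec c) i =
      c i + φ i (D (∑ j, c j • y j)) := by
    intro c i
    simp [perturbationMatrix, Matrix.mulVec, dotProduct, mul_comm, mul_add,
      Finset.sum_add_distrib, Matrix.one_apply]
  rw [injective_iff_map_eq_zero]
  constructor
  · intro hinj hdet
    obtain ⟨c, hc, hMc⟩ := Matrix.exists_mulVec_eq_zero_iff.mpr hdet
    have h1 : ∀ i, φ i (D (∑ j, c j • y j)) = - c i := fun i => by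
      have := hmul c i
      rw [hMc] at this
      exact (neg_eq_of_add_eq_zero_right this.symm).symm
    have h2 := hinj (D (∑ j, c j • y j)) (by
      rw [hL, hG]
      simp only [h1, neg_smul, Finset.sum_neg_distrib, add_neg_cancel])
    apply hc
    ext i
    have := h1 i
    rw [h2, map_zero] at this
    simpa using this.symm
  · intro hdet x hx
    have hxD : x = - D (∑ j, φ j x • y j) := by
      rw [hL] at hx
      rw [← map_neg, ← eq_neg_of_add_eq_zero_left hx, hD]
    have hc : (fun i => φ i x) = 0 := by
      apply Matrix.eq_zero_of_mulVec_eq_zero hdet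
      ext i
      rw [hmul, ← neg_eq_iff_eq_neg.mpr hxD]
      simp
    rw [hxD]
    simp [fun i => congrFun hc i]

end Perturbation

/-! ### Fredholm alternative and analytic Fredholm theorem -/

section AnalyticFredholm

variable {X : Type*} [NormedAddCommGroup X] [NormedSpace ℂ X]

/-- `L` is the sum of an invertible operator and an operator of finite rank. -/
def IsUnitAddFiniteRank (L : X →L[ℂ] X) : Prop :=
  ∃ G F : X →L[ℂ] X, IsUnit G ∧ F ∈ finiteRankOperators X X ∧ L = G + F

/-- Invertible operators form an open set, so the small remainder K - F of a finite-rank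
approximation F can be absorbed into G. -/
theorem IsUnit.isUnitAddFiniteRank_add [CompleteSpace X] {G K : X →L[ℂ] X} (hG : IsUnit G)
    (hK : K ∈ approximableOperators X X) : IsUnitAddFiniteRank (G + K) := by
  have hopen : {F : X →L[ℂ] X | IsUnit (G + (K - F))} ∈ 𝓝 K := by
    have : IsOpen {F : X →L[ℂ] X | IsUnit (G + (K - F))} :=
      Units.isOpen.preimage (by fun_prop : Continuous fun F : X →L[ℂ] X => G + (K - F))
    exact this.mem_nhds (by simpa using hG)
  obtain ⟨F, hF, hFr⟩ := mem_closure_iff_nhds.mp hK _ hopen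
  exact ⟨_, F, hF, hFr, by abel⟩

/-- Injectivity makes the determinant nonzero, which yields a right inverse and hence surjectivity.
-/
theorem IsUnitAddFiniteRank.isUnit_of_injective [CompleteSpace X] {L : X →L[ℂ] X}
    (h : IsUnitAddFiniteRank L) (hinj : Function.Injective L) : IsUnit L := by
  obtain ⟨G, F, ⟨u, rfl⟩, hF, rfl⟩ := h
  obtain ⟨m, φ, y, hFs⟩ := exists_eq_sum_of_mem_finiteRankOperators hF
  have hL : ∀ x, (↑u + F) x = (u : X →L[ℂ] X) x + ∑ i, φ i x • y i := fun x => by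
    rw [add_apply, hFs]
  have hdet := (injective_iff_det_perturbationMatrix_ne_zero u.mul_inv u.inv_mul hL).mp hinj
  have hright := mul_perturbationInverse u.mul_inv hL hdet
  rw [ContinuousLinearMap.isUnit_iff_bijective]
  exact ⟨hinj, fun x => ⟨_, congrArg (fun B : X →L[ℂ] X => B x) hright⟩⟩

/-- On ker F, which has finite codimension, the operator agrees with the invertible part and so has
closed image; the full range adds only finitely many dimensions. -/
theorem IsUnitAddFiniteRank.isClosed_range {L : X →L[ℂ] X} (h : IsUnitAddFiniteRank L) :
    IsClosed (Set.range L) := by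
  obtain ⟨G, F, ⟨u, rfl⟩, hF, rfl⟩ := h
  have : F.ker.CoFG := LinearMap.ker_coFG_iff_hasFiniteRange.mpr hF
  have hclosed : IsClosed ((F.ker.map ((↑u + F : X →L[ℂ] X) : X →ₗ[ℂ] X) : Submodule ℂ X) :
      Set X) := by
    have : ((F.ker.map ((↑u + F : X →L[ℂ] X) : X →ₗ[ℂ] X) : Submodule ℂ X) : Set X) =
        (↑u⁻¹ : X →L[ℂ] X) ⁻¹' F.ker := by
      ext x
      have h1 : ∀ x, (↑u : X →L[ℂ] X) ((↑u⁻¹ : X →L[ℂ] X) x) = x :=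
        fun x => congrArg (fun B : X →L[ℂ] X => B x) u.mul_inv
      have h2 : ∀ x, (↑u⁻¹ : X →L[ℂ] X) ((↑u : X →L[ℂ] X) x) = x :=
        fun x => congrArg (fun B : X →L[ℂ] X => B x) u.inv_mul
      constructor
      · rintro ⟨v, hv, rfl⟩
        have hv' : F v = 0 := hv
        simp [hv', h2]
      · intro hx
        have hx' : F ((↑u⁻¹ : X →L[ℂ] X) x) = 0 := hx
        exact ⟨_, hx, by simp [hx', h1]⟩
    rw [this]
    exact F.isClosed_ker.preimage (ContinuousLinearMap.continuous _)
  exact LinearMap.isClosed_range_of_isClosed_map_of_finiteDimensional_quotient hclosed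

/-- A kernel vector satisfies x = G⁻¹F(-x), so the kernel sits inside the image of ran F under G⁻¹.
-/
theorem IsUnitAddFiniteRank.finiteDimensional_ker {L : X →L[ℂ] X} (h : IsUnitAddFiniteRank L) :
    FiniteDimensional ℂ L.ker := by
  obtain ⟨G, F, ⟨u, rfl⟩, hF, rfl⟩ := h
  have : FiniteDimensional ℂ F.range := Module.Finite.of_fg hF
  have hle : ((↑u + F : X →L[ℂ] X)).ker ≤ F.range.map ((↑u⁻¹ : X →L[ℂ] X) : X →ₗ[ℂ] X) := by
    intro x hx
    have hx' : (↑u : X →L[ℂ] X) x + F x = 0 := hx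
    refine ⟨F (-x), ⟨-x, rfl⟩, ?_⟩
    have h2 : (↑u⁻¹ : X →L[ℂ] X) ((↑u : X →L[ℂ] X) x) = x :=
      congrArg (fun B : X →L[ℂ] X => B x) u.inv_mul
    simp only [map_neg, ← eq_neg_of_add_eq_zero_left hx', ContinuousLinearMap.coe_coe, h2]
  exact Submodule.finiteDimensional_of_le hle

theorem IsUnitAddFiniteRank.mul {L M : X →L[ℂ] X} (hL : IsUnitAddFiniteRank L)
    (hM : IsUnitAddFiniteRank M) : IsUnitAddFiniteRank (L * M) := by
  obtain ⟨G, F, hG, hF, rfl⟩ := hL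
  obtain ⟨G', F', hG', hF', rfl⟩ := hM
  refine ⟨G * G', G * F' + F * (G' + F'), hG.mul hG', ?_, by noncomm_ring⟩
  exact add_mem (comp_mem_finiteRankOperators_left G hF')
    (comp_mem_finiteRankOperators_right hF _)

theorem IsUnitAddFiniteRank.pow {L : X →L[ℂ] X} (hL : IsUnitAddFiniteRank L) (k : ℕ) :
    IsUnitAddFiniteRank (L ^ k) := by
  induction k with
  | zero => exact ⟨1, 0, isUnit_one, zero_mem _, by simp⟩
  | succ k ih => rw [pow_succ]; exact ih.mul hL

theorem AnalyticAt.ringInverse {R : Type*} [NormedRing R] [NormedAlgebra ℂ R] [CompleteSpace R]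
    {f : ℂ → R} {z : ℂ} (hf : AnalyticAt ℂ f z) (hz : IsUnit (f z)) :
    AnalyticAt ℂ (fun w => Ring.inverse (f w)) z := by
  obtain ⟨u, hu⟩ := hz
  have := analyticAt_inverse (𝕜 := ℂ) u
  rw [hu] at this
  exact this.comp hf

theorem AnalyticAt.matrix_det {m : ℕ} {M : ℂ → Matrix (Fin m) (Fin m) ℂ} {z : ℂ}
    (hM : ∀ i j, AnalyticAt ℂ (fun w => M w i j) z) : AnalyticAt ℂ (fun w => (M w).det) z := by
  simp only [Matrix.det_apply]
  refine Finset.analyticAt_fun_sum _ fun σ _ => ?_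
  simp only [Units.smul_def, zsmul_eq_mul]
  exact analyticAt_const.mul (Finset.analyticAt_fun_prod _ fun i _ => hM _ _)

theorem AnalyticAt.matrix_adjugate {m : ℕ} {M : ℂ → Matrix (Fin m) (Fin m) ℂ} {z : ℂ}
    (hM : ∀ i j, AnalyticAt ℂ (fun w => M w i j) z) (i j : Fin m) :
    AnalyticAt ℂ (fun w => (M w).adjugate i j) z := by
  simp only [Matrix.adjugate_apply]
  refine AnalyticAt.matrix_det fun k l => ?_
  by_cases hk : k = j
  · subst hk
    simpa using analyticAt_const
  · simpa [Matrix.updateRow_ne hk] using hM k l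

/-- Freeze the finite-rank part F at z: L(w) - F stays invertible near z, so invertibility of L(w)
is decided by a scalar analytic determinant, which near z vanishes identically or only possibly at
z. In the second case the Woodbury formula shows that the inverse is meromorphic. -/
theorem AnalyticAt.isUnit_dichotomy [CompleteSpace X] {L : ℂ → X →L[ℂ] X} {z : ℂ}
    (hL : AnalyticAt ℂ L z) (hz : IsUnitAddFiniteRank (L z)) :
    (∀ᶠ w in 𝓝 z, ¬ IsUnit (L w)) ∨
      (∀ᶠ w in 𝓝[≠] z, IsUnit (L w)) ∧ MeromorphicAt (fun w => Ring.inverse (L w)) z := by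
  obtain ⟨G₀, F, hG₀, hF, hGF⟩ := hz
  obtain ⟨m, φ, y, hFs⟩ := exists_eq_sum_of_mem_finiteRankOperators hF
  set G : ℂ → X →L[ℂ] X := fun w => L w - F with hGdef
  have hGan : AnalyticAt ℂ G z := hL.sub analyticAt_const
  have hGz : IsUnit (G z) := by simpa [hGdef, hGF] using hG₀
  have hGunit : ∀ᶠ w in 𝓝 z, IsUnit (G w) :=
    hGan.continuousAt.eventually_mem (Units.isOpen.mem_nhds hGz)
  set D : ℂ → X →L[ℂ] X := fun w => Ring.inverse (G w) with hDdef
  have hDan : AnalyticAt ℂ D z := hGan.ringInverse hGz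
  have hDy : ∀ i, AnalyticAt ℂ (fun w => D w (y i)) z := fun i =>
    ((ContinuousLinearMap.apply ℂ X (y i)).analyticAt _).comp hDan
  have hMan : ∀ i j, AnalyticAt ℂ (fun w => perturbationMatrix (D w) φ y i j) z := by
    intro i j
    have := (analyticAt_const (v := (1 : Matrix (Fin m) (Fin m) ℂ) i j)).add
      (((φ i).analyticAt _).comp (hDy j))
    exact this
  have hsum : ∀ w x, L w x = G w x + ∑ i, φ i x • y i := fun w x => by
    simp [hGdef, hFs]
  have hdet_iff : ∀ w, IsUnit (G w) →
      (IsUnit (L w) ↔ (perturbationMatrix (D w) φ y).det ≠ 0) := by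
    intro w hw
    rw [← injective_iff_det_perturbationMatrix_ne_zero (Ring.mul_inverse_cancel _ hw)
      (Ring.inverse_mul_cancel _ hw) (hsum w)]
    refine ⟨fun h => (ContinuousLinearMap.isUnit_iff_bijective.mp h).1, fun h => ?_⟩
    exact IsUnitAddFiniteRank.isUnit_of_injective ⟨G w, F, hw, hF, by simp [hGdef]⟩ h
  have hdetan := AnalyticAt.matrix_det hMan
  rcases hdetan.eventually_eq_zero_or_eventually_ne_zero with h0 | h0
  · left
    filter_upwards [h0, hGunit] with w hw hGw
    rw [hdet_iff w hGw, not_not, hw]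
  · right
    have hGunit' : ∀ᶠ w in 𝓝[≠] z, IsUnit (G w) := hGunit.filter_mono nhdsWithin_le_nhds
    have hunit : ∀ᶠ w in 𝓝[≠] z, IsUnit (L w) := by
      filter_upwards [h0, hGunit'] with w hw hGw using (hdet_iff w hGw).mpr hw
    refine ⟨hunit, ?_⟩
    have hmero : MeromorphicAt (fun w => perturbationInverse (D w) φ y) z := by
      refine hDan.meromorphicAt.sub (MeromorphicAt.fun_sum fun i _ =>
        MeromorphicAt.fun_sum fun j _ => ?_)
      refine ((hdetan.meromorphicAt.inv).mul
        (AnalyticAt.matrix_adjugate hMan i j).meromorphicAt).smul (AnalyticAt.meromorphicAt ?_)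
      have h1 : AnalyticAt ℂ (fun w => (φ j) ∘L (D w)) z :=
        ((ContinuousLinearMap.compL ℂ X X ℂ (φ j)).analyticAt _).comp hDan
      have h2 : AnalyticAt ℂ (fun p : (X →L[ℂ] ℂ) × X =>
          ContinuousLinearMap.smulRightL ℂ X X p.1 p.2) ((φ j) ∘L (D z), D z (y i)) :=
        (ContinuousLinearMap.smulRightL ℂ X X).analyticAt_bilinear _
      exact AnalyticAt.comp (f := fun w => ((φ j) ∘L (D w), D w (y i))) h2 (h1.prod (hDy i))
    refine hmero.congr ?_
    filter_upwards [h0, hGunit', hunit] with w hw hGw hLw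
    have h1 := mul_perturbationInverse (Ring.mul_inverse_cancel _ hGw) (hsum w) hw
    have h2 := Ring.inverse_mul_cancel _ hLw
    calc perturbationInverse (D w) φ y
        = (Ring.inverse (L w) * L w) * perturbationInverse (D w) φ y := by rw [h2, one_mul]
      _ = _ := by rw [mul_assoc, h1, mul_one]

/-- The analytic Fredholm theorem, for perturbations of invertible operators by operators of
finite rank. -/
theorem analyticFredholm [CompleteSpace X] {L : ℂ → X →L[ℂ] X} {Ω : Set ℂ}
    (hΩ : IsPreconnected Ω) (hL : ∀ z ∈ Ω, AnalyticAt ℂ L z)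
    (hLf : ∀ z ∈ Ω, IsUnitAddFiniteRank (L z)) {z₀ : ℂ} (hz₀ : z₀ ∈ Ω) (hu : IsUnit (L z₀))
    {z : ℂ} (hz : z ∈ Ω) :
    (∀ᶠ w in 𝓝[≠] z, IsUnit (L w)) ∧ MeromorphicAt (fun w => Ring.inverse (L w)) z := by
  refine ((hL z hz).isUnit_dichotomy (hLf z hz)).resolve_left fun hbad => ?_
  -- The two alternatives of the dichotomy define disjoint open sets covering Ω; the second contains
  -- z₀, so connectedness excludes the first.
  have hdisj : ∀ w, ¬ ((∀ᶠ v in 𝓝 w, ¬ IsUnit (L v)) ∧ ∀ᶠ v in 𝓝[≠] w, IsUnit (L v)) := by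
    rintro w ⟨h1, h2⟩
    obtain ⟨v, hv1, hv2⟩ := ((h1.filter_mono nhdsWithin_le_nhds).and h2).exists
    exact hv1 hv2
  have hopen : IsOpen {w | ∀ᶠ v in 𝓝[≠] w, IsUnit (L v)} := by
    refine isOpen_iff_mem_nhds.mpr fun w hw => ?_
    have h2 := eventually_eventually_nhdsWithin.mpr hw
    rw [eventually_nhdsWithin_iff] at h2
    filter_upwards [h2] with v hv
    by_cases hvw : v = w
    · rwa [hvw]
    · refine Filter.Eventually.filter_mono ?_ (hv hvw)
      rw [isOpen_compl_singleton.nhdsWithin_eq hvw]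
      exact nhdsWithin_le_nhds
  have hcover : Ω ⊆ {w | ∀ᶠ v in 𝓝 w, ¬ IsUnit (L v)} ∪ {w | ∀ᶠ v in 𝓝[≠] w, IsUnit (L v)} :=
    fun w hw => ((hL w hw).isUnit_dichotomy (hLf w hw)).imp id And.left
  have hz₀' : ∀ᶠ v in 𝓝[≠] z₀, IsUnit (L v) :=
    ((hL z₀ hz₀).continuousAt.eventually_mem (Units.isOpen.mem_nhds hu)).filter_mono
      nhdsWithin_le_nhds
  obtain ⟨w, -, hw1, hw2⟩ := hΩ _ _ isOpen_setOfPred_eventually_nhds hopen hcover ⟨z, hz, hbad⟩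
    ⟨z₀, hz₀, hz₀'⟩
  exact hdisj w ⟨hw1, hw2⟩

end AnalyticFredholm

/-! ### From an unbounded operator to the pencil of its resolvent -/

namespace UnboundedOp

variable {X : Type*} [NormedAddCommGroup X] [NormedSpace ℂ X] {A : X →ₗ.[ℂ] X} {z₀ : ℂ}
  {T : X →L[ℂ] X}

/-- The bounded operator `(A - w) T = 1 - (w - z₀) T`, where `T = (A - z₀)⁻¹`. -/
def pencil (T : X →L[ℂ] X) (z₀ w : ℂ) : X →L[ℂ] X := 1 - (w - z₀) • T

theorem pencil_apply (T : X →L[ℂ] X) (z₀ w : ℂ) (f : X) :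
    pencil T z₀ w f = f - (w - z₀) • T f := rfl

theorem pencil_self (T : X →L[ℂ] X) (z₀ : ℂ) : pencil T z₀ z₀ = 1 := by simp [pencil]

theorem commute_pencil (T : X →L[ℂ] X) (z₀ w : ℂ) : Commute (pencil T z₀ w) T :=
  (Commute.one_left T).sub_left ((Commute.refl T).smul_left _)

theorem analyticAt_pencil (T : X →L[ℂ] X) (z₀ w : ℂ) : AnalyticAt ℂ (pencil T z₀) w :=
  analyticAt_const.sub ((analyticAt_id.sub analyticAt_const).smul analyticAt_const)

theorem continuous_pencil (T : X →L[ℂ] X) (z₀ : ℂ) : Continuous (pencil T z₀) := by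
  unfold pencil
  fun_prop

theorem shift_eq_sub (A : X →ₗ.[ℂ] X) (z w : ℂ) (u : A.domain) :
    shift A w u = shift A z u - (w - z) • (u : X) := by
  simp only [shift, LinearMap.sub_apply, LinearMap.smul_apply, Submodule.subtype_apply, sub_smul]
  abel

/-- The factorization A - w = L(w)(A - z₀), with A - z₀ bijective from the domain onto X, is what
transfers range, kernel and invertibility to the bounded operator L(w). -/
theorem IsResolventAt.shift_eq_pencil (hT : IsResolventAt A z₀ T) (w : ℂ) (u : A.domain) :
    shift A w u = pencil T z₀ w (shift A z₀ u) := by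
  rw [pencil_apply, hT.2, shift_eq_sub A z₀ w]

theorem IsResolventAt.isResolventAt_mul (hT : IsResolventAt A z₀ T) {w : ℂ}
    (hw : IsUnit (pencil T z₀ w)) : IsResolventAt A w (T * Ring.inverse (pencil T z₀ w)) := by
  constructor
  · intro f
    obtain ⟨h, hf⟩ := hT.1 (Ring.inverse (pencil T z₀ w) f)
    refine ⟨h, ?_⟩
    rw [hT.shift_eq_pencil]
    have : shift A z₀ ⟨(T * Ring.inverse (pencil T z₀ w)) f, h⟩ =
      Ring.inverse (pencil T z₀ w) f := hf
    rw [this]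
    exact congrArg (fun B : X →L[ℂ] X => B f) (Ring.mul_inverse_cancel _ hw)
  · intro u
    rw [hT.shift_eq_pencil]
    have h1 : Ring.inverse (pencil T z₀ w) (pencil T z₀ w (shift A z₀ u)) = shift A z₀ u :=
      congrArg (fun B : X →L[ℂ] X => B (shift A z₀ u)) (Ring.inverse_mul_cancel _ hw)
    rw [mul_apply_eq_comp, h1, hT.2]

/-- The inverse is 1 + (w - z₀)R; the two products are checked with the first resolvent identity in
its two orders. -/
theorem IsResolventAt.isUnit_pencil (hT : IsResolventAt A z₀ T) {w : ℂ} {R : X →L[ℂ] X}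
    (hR : IsResolventAt A w R) : IsUnit (pencil T z₀ w) := by
  have h1 : ∀ f, T f = R f - (w - z₀) • R (T f) := by
    intro f
    obtain ⟨h, hf⟩ := hT.1 f
    have := hR.2 ⟨T f, h⟩
    rw [shift_eq_sub A z₀ w, hf, map_sub, map_smul] at this
    exact this.symm
  have h2 : ∀ f, R f = T f + (w - z₀) • T (R f) := by
    intro f
    obtain ⟨h, hf⟩ := hR.1 f
    have := hT.2 ⟨R f, h⟩
    rw [shift_eq_sub A w z₀, hf, map_sub, map_smul] at this
    refine this.symm.trans ?_
    module
  refine ⟨⟨pencil T z₀ w, 1 + (w - z₀) • R, ?_, ?_⟩, rfl⟩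
  · ext f
    have := h2 f
    simp only [mul_apply_eq_comp, add_apply, smul_apply, pencil_apply, map_add, map_smul,
      one_apply_eq_self]
    nth_rewrite 1 [this]
    module
  · ext f
    have := h1 f
    simp only [mul_apply_eq_comp, add_apply, smul_apply, pencil_apply, map_sub, map_smul,
      one_apply_eq_self]
    nth_rewrite 1 [this]
    module

theorem IsResolventAt.mem_resolventSet_iff (hT : IsResolventAt A z₀ T) (w : ℂ) :
    w ∈ resolventSet A ↔ IsUnit (pencil T z₀ w) :=
  ⟨fun ⟨_, hR⟩ => hT.isUnit_pencil hR, fun h => ⟨_, hT.isResolventAt_mul h⟩⟩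

/-- No condition on w is needed: off the resolvent set both sides take their default value 0. -/
theorem IsResolventAt.resolvent_eq (hT : IsResolventAt A z₀ T) (w : ℂ) :
    resolvent A w = T * Ring.inverse (pencil T z₀ w) := by
  by_cases hw : IsUnit (pencil T z₀ w)
  · exact (isResolventAt_resolvent ((hT.mem_resolventSet_iff w).mpr hw)).unique
      (hT.isResolventAt_mul hw)
  · rw [Ring.inverse_non_unit _ hw, mul_zero, resolvent, dif_neg]
    exact fun h => hw ((hT.mem_resolventSet_iff w).mp h)

theorem IsResolventAt.range_shift (hT : IsResolventAt A z₀ T) (w : ℂ) :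
    Set.range (shift A w) = Set.range (pencil T z₀ w) := by
  ext g
  constructor
  · rintro ⟨u, rfl⟩
    exact ⟨_, (hT.shift_eq_pencil w u).symm⟩
  · rintro ⟨f, rfl⟩
    obtain ⟨h, hf⟩ := hT.1 f
    exact ⟨⟨T f, h⟩, by rw [hT.shift_eq_pencil, hf]⟩

theorem IsResolventAt.isEigenvalue_iff (hT : IsResolventAt A z₀ T) (w : ℂ) :
    IsEigenvalue A w ↔ ¬ Function.Injective (pencil T z₀ w) := by
  rw [injective_iff_map_eq_zero]
  constructor
  · rintro ⟨f, hf, hAf⟩ hinj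
    have h0 : shift A w f = 0 := sub_eq_zero.mpr hAf
    rw [hT.shift_eq_pencil] at h0
    have := hT.2 f
    rw [hinj _ h0, map_zero] at this
    exact hf (Subtype.ext this.symm)
  · intro h
    push Not at h
    obtain ⟨g, hg, hg0⟩ := h
    obtain ⟨hd, hg'⟩ := hT.1 g
    refine ⟨⟨T g, hd⟩, fun h0 => hg0 ?_, ?_⟩
    · rw [← hg', h0, map_zero]
    · have : shift A w ⟨T g, hd⟩ = 0 := by rw [hT.shift_eq_pencil, hg', hg]
      exact sub_eq_zero.mp this

/-- On the domain L(w)u = T(A - w)u, and T commutes with L(w), so each factor A - w can be traded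
for a factor L(w). -/
theorem IsResolventAt.kerPow_le (hT : IsResolventAt A z₀ T) (w : ℂ) (k : ℕ) :
    kerPow A w k ≤ (pencil T z₀ w ^ k).ker := by
  induction k with
  | zero => exact bot_le
  | succ k ih =>
    rintro _ ⟨u, hu, rfl⟩
    have h1 : (pencil T z₀ w ^ k) (shift A w u) = 0 := ih hu
    have h2 : pencil T z₀ w (u : X) = T (shift A w u) := by
      rw [hT.shift_eq_pencil, ← mul_apply_eq_comp T, ← (commute_pencil T z₀ w).eq,
        mul_apply_eq_comp, hT.2]
    have h3 : (pencil T z₀ w ^ k) (T (shift A w u)) = T ((pencil T z₀ w ^ k) (shift A w u)) :=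
      congrArg (fun B : X →L[ℂ] X => B _) ((commute_pencil T z₀ w).pow_left k).eq
    change (pencil T z₀ w ^ (k + 1)) (u : X) = 0
    rw [pow_succ, mul_apply_eq_comp, h2, h3, h1, map_zero]

/-- Since L(w) = L(z) - (w - z)T with commuting terms, this is the factorization of aᵐ - bᵐ by a -
b. -/
theorem pencil_pow_sub (T : X →L[ℂ] X) (z₀ z w : ℂ) (m : ℕ) :
    (∑ i ∈ Finset.range m, pencil T z₀ z ^ i * ((w - z) • T) ^ (m - 1 - i)) * pencil T z₀ w =
      pencil T z₀ z ^ m - ((w - z) • T) ^ m := by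
  have h : pencil T z₀ w = pencil T z₀ z - (w - z) • T := by
    simp only [pencil, sub_sub, ← add_smul]
    ring_nf
  rw [h]
  exact ((commute_pencil T z₀ z).smul_right _).geom_sum₂_mul m

/-- If `(w - z) ^ m L(w)⁻¹` stays bounded as `w → z`, then the ascent of `L(z)` is at most `m`. -/
theorem pencil_pow_eq_zero {z : ℂ} {m : ℕ} {E : ℂ → X →L[ℂ] X} (hE : ContinuousAt E z)
    (hu : ∀ᶠ w in 𝓝[≠] z, IsUnit (pencil T z₀ w) ∧
      E w = (w - z) ^ m • Ring.inverse (pencil T z₀ w))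
    {f : X} (hf : (pencil T z₀ z ^ (m + 1)) f = 0) : (pencil T z₀ z ^ m) f = 0 := by
  -- For L(z)^(m+1) f = 0 the factorization gives L(w)Q(w)f = -(w - z)^(m+1) T^(m+1) f, so Q(w)f =
  -- -(w - z) T^(m+1) E(w) f tends to 0, whereas Q(z) = L(z)^m.
  set Q : ℂ → X →L[ℂ] X := fun w =>
    ∑ i ∈ Finset.range (m + 1), pencil T z₀ z ^ i * ((w - z) • T) ^ (m + 1 - 1 - i) with hQ
  have hQc : Continuous Q := by fun_prop
  have hQz : Q z = pencil T z₀ z ^ m := by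
    rw [hQ]
    simp only [sub_self, zero_smul]
    rw [Finset.sum_eq_single_of_mem m (by simp)]
    · simp
    · intro i hi him
      have : m + 1 - 1 - i ≠ 0 := by
        have := Finset.mem_range.mp hi
        omega
      rw [zero_pow this, mul_zero]
  have hQeq : ∀ᶠ w in 𝓝[≠] z, Q w f = -((w - z) • (T ^ (m + 1)) (E w f)) := by
    filter_upwards [hu] with w ⟨hw, hEw⟩
    have hcomm : Commute (pencil T z₀ w) (Q w) := by
      refine Commute.sum_right _ _ _ fun i _ => Commute.mul_right (Commute.pow_right ?_ _)
        (((commute_pencil T z₀ w).smul_right _).pow_right _)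
      exact (Commute.one_right _).sub_right ((commute_pencil T z₀ w).smul_right _)
    have h1 : pencil T z₀ w (Q w f) = -((w - z) ^ (m + 1) • (T ^ (m + 1)) f) := by
      have := congrArg (fun B : X →L[ℂ] X => B f) (pencil_pow_sub T z₀ z w (m + 1))
      rw [← mul_apply_eq_comp, hcomm.eq]
      refine this.trans ?_
      simp [hf, smul_pow]
    have h2 : Ring.inverse (pencil T z₀ w) (pencil T z₀ w (Q w f)) = Q w f :=
      congrArg (fun B : X →L[ℂ] X => B (Q w f)) (Ring.inverse_mul_cancel _ hw)
    have h3 : Commute (Ring.inverse (pencil T z₀ w)) (T ^ (m + 1)) := by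
      obtain ⟨u, hu⟩ := hw
      rw [← hu, Ring.inverse_unit]
      refine Commute.units_inv_left ?_
      rw [hu]
      exact (commute_pencil T z₀ w).pow_right _
    have h4 : Ring.inverse (pencil T z₀ w) ((T ^ (m + 1)) f) =
        (T ^ (m + 1)) (Ring.inverse (pencil T z₀ w) f) :=
      congrArg (fun B : X →L[ℂ] X => B f) h3.eq
    rw [← h2, h1, hEw, map_neg, map_smul, h4, smul_apply, map_smul, smul_smul, pow_succ' (w - z)]
  have hl1 : Tendsto (fun w => Q w f) (𝓝[≠] z) (𝓝 ((pencil T z₀ z ^ m) f)) := by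
    rw [← hQz]
    exact ((hQc.clm_apply continuous_const).tendsto z).mono_left nhdsWithin_le_nhds
  have hl2 : Tendsto (fun w => -((w - z) • (T ^ (m + 1)) (E w f))) (𝓝[≠] z) (𝓝 0) := by
    have : ContinuousAt (fun w => -((w - z) • (T ^ (m + 1)) (E w f))) z := by fun_prop
    have h := this.tendsto
    simp only [sub_self, zero_smul, neg_zero] at h
    exact h.mono_left nhdsWithin_le_nhds
  exact tendsto_nhds_unique hl1 (hl2.congr' (hQeq.mono fun w hw => hw.symm))

theorem ker_pencil_pow_le {z : ℂ} {m : ℕ} {E : ℂ → X →L[ℂ] X} (hE : ContinuousAt E z)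
    (hu : ∀ᶠ w in 𝓝[≠] z, IsUnit (pencil T z₀ w) ∧
      E w = (w - z) ^ m • Ring.inverse (pencil T z₀ w)) (k : ℕ) :
    (pencil T z₀ z ^ k).ker ≤ (pencil T z₀ z ^ m).ker := by
  rcases le_total k m with h | h
  · intro f hf
    have hf' : (pencil T z₀ z ^ k) f = 0 := hf
    change (pencil T z₀ z ^ m) f = 0
    rw [← Nat.sub_add_cancel h, pow_add, mul_apply_eq_comp, hf', map_zero]
  · induction k, h using Nat.le_induction with
    | base => exact le_rfl
    | succ k hk ih =>
      refine le_trans (fun f hf => ?_) ih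
      have hf' : (pencil T z₀ z ^ (k + 1)) f = 0 := hf
      -- With k = m + j, the one-step result is applied to L(z)^j f.
      obtain ⟨j, rfl⟩ := Nat.exists_eq_add_of_le hk
      rw [add_right_comm, pow_add, mul_apply_eq_comp] at hf'
      have := pencil_pow_eq_zero hE hu hf'
      change (pencil T z₀ z ^ (m + j)) f = 0
      rwa [pow_add, mul_apply_eq_comp]

/-- If `(w - z) ^ m L(w)⁻¹` extends holomorphically to a disc about `z`, then the range of the
Riesz projection is contained in the kernel of `L(z) ^ m`. -/
theorem IsResolventAt.range_rieszProjection_le [CompleteSpace X] (hT : IsResolventAt A z₀ T)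
    {z : ℂ} {r : ℝ} (hr : 0 < r) {m : ℕ} {E : ℂ → X →L[ℂ] X}
    (hE : DifferentiableOn ℂ E (Metric.closedBall z r))
    (hu : ∀ w ∈ Metric.sphere z r, IsUnit (pencil T z₀ w) ∧
      E w = (w - z) ^ m • Ring.inverse (pencil T z₀ w)) :
    (rieszProjection A z r).range ≤ (pencil T z₀ z ^ m).ker := by
  set Q : ℂ → X →L[ℂ] X := fun w =>
    ∑ i ∈ Finset.range m, pencil T z₀ z ^ i * ((w - z) • T) ^ (m - 1 - i) with hQ
  have hQd : Differentiable ℂ Q := by fun_prop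
  have hR : ContinuousOn (resolvent A) (Metric.sphere z r) := by
    intro w hw
    have h1 := (analyticAt_const (v := T)).mul
      ((analyticAt_pencil T z₀ w).ringInverse (hu w hw).1)
    refine (h1.continuousAt.congr (Eventually.of_forall fun v => ?_)).continuousWithinAt
    exact (hT.resolvent_eq v).symm
  have hint : CircleIntegrable (resolvent A) z r := hR.circleIntegrable hr.le
  -- On the circle L(z)^m (A - w)⁻¹ = T Q(w) + T^(m+1) E(w); the right side is holomorphic on the
  -- whole disc, so Cauchy's theorem kills the integral.
  have hzero : pencil T z₀ z ^ m * (∮ w in C(z, r), resolvent A w) = 0 := by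
    have h1 : pencil T z₀ z ^ m * (∮ w in C(z, r), resolvent A w) =
        ∮ w in C(z, r), pencil T z₀ z ^ m * resolvent A w := by
      simp only [circleIntegral, ← mul_smul_comm]
      exact ((ContinuousLinearMap.mul ℂ (X →L[ℂ] X)
        (pencil T z₀ z ^ m)).intervalIntegral_comp_comm hint.out).symm
    have h2 : ∮ w in C(z, r), pencil T z₀ z ^ m * resolvent A w =
        ∮ w in C(z, r), (T * Q w + T ^ (m + 1) * E w) := by
      refine circleIntegral.integral_congr hr.le fun w hw => ?_
      obtain ⟨hw1, hw2⟩ := hu w hw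
      have h3 : pencil T z₀ z ^ m = Q w * pencil T z₀ w + (w - z) ^ m • T ^ m := by
        rw [hQ, pencil_pow_sub, smul_pow]
        abel
      have h4 : pencil T z₀ z ^ m * T = T * pencil T z₀ z ^ m :=
        ((commute_pencil T z₀ z).pow_left m).eq
      rw [hT.resolvent_eq, ← mul_assoc, h4, h3, mul_assoc, add_mul, mul_assoc,
        Ring.mul_inverse_cancel _ hw1, mul_one, mul_add, hw2, pow_succ', smul_mul_assoc,
        mul_smul_comm, mul_smul_comm, mul_assoc]
    rw [h1, h2]
    have hd : DifferentiableOn ℂ (fun w => T * Q w + T ^ (m + 1) * E w)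
        (Metric.closedBall z r) :=
      ((hQd.const_mul T).differentiableOn).add (hE.const_mul _)
    have hd' : DiffContOnCl ℂ (fun w => T * Q w + T ^ (m + 1) * E w) (Metric.ball z r) :=
      (hd.mono Metric.closure_ball_subset_closedBall).diffContOnCl
    exact hd'.circleIntegral_eq_zero hr.le
  rintro _ ⟨f, rfl⟩
  have := congrArg (fun B : X →L[ℂ] X => B f) hzero
  simp only [mul_apply_eq_comp, zero_apply] at this
  change (pencil T z₀ z ^ m) (rieszProjection A z r f) = 0
  rw [rieszProjection, smul_apply, map_smul, this, smul_zero]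

/-! ### Spectral consequences in Ω -/

section AnalyticFredholm

variable [CompleteSpace X] {Ω : Set ℂ} {z : ℂ}

theorem eventually_mem_resolventSet (hT : IsResolventAt A z₀ T) (hΩ : IsPreconnected Ω)
    (hz₀ : z₀ ∈ Ω) (hfin : ∀ w ∈ Ω, IsUnitAddFiniteRank (pencil T z₀ w)) (hz : z ∈ Ω) :
    ∀ᶠ w in 𝓝[≠] z, w ∈ resolventSet A := by
  simp only [hT.mem_resolventSet_iff]
  exact (analyticFredholm hΩ (fun w _ => analyticAt_pencil T z₀ w) hfin hz₀
    (by rw [pencil_self]; exact isUnit_one) hz).1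

theorem meromorphicAt_inverse_pencil (hΩ : IsPreconnected Ω)
    (hz₀ : z₀ ∈ Ω) (hfin : ∀ w ∈ Ω, IsUnitAddFiniteRank (pencil T z₀ w)) (hz : z ∈ Ω) :
    MeromorphicAt (fun w => Ring.inverse (pencil T z₀ w)) z :=
  (analyticFredholm hΩ (fun w _ => analyticAt_pencil T z₀ w) hfin hz₀
    (by rw [pencil_self]; exact isUnit_one) hz).2

theorem meromorphicOn_resolvent (hT : IsResolventAt A z₀ T) (hΩ : IsPreconnected Ω)
    (hz₀ : z₀ ∈ Ω) (hfin : ∀ w ∈ Ω, IsUnitAddFiniteRank (pencil T z₀ w)) :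
    MeromorphicOn (resolvent A) Ω := by
  intro z hz
  obtain ⟨m, hm⟩ := meromorphicAt_inverse_pencil hΩ hz₀ hfin hz
  refine ⟨m, (analyticAt_const (v := T).mul hm).congr (Eventually.of_forall fun w => ?_)⟩
  simp only [Pi.mul_apply, mul_smul_comm, hT.resolvent_eq]

/-- If the resolvent has a limit R at z, then L(w)⁻¹ = 1 + (w - z₀)(A - w)⁻¹ has one too, and that
limit inverts L(z). The order is insensitive to the default value of the resolvent at z itself. -/
theorem meromorphicOrderAt_resolvent_neg_iff (hT : IsResolventAt A z₀ T) (hΩ : IsPreconnected Ω)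
    (hz₀ : z₀ ∈ Ω) (hfin : ∀ w ∈ Ω, IsUnitAddFiniteRank (pencil T z₀ w)) (hz : z ∈ Ω) :
    meromorphicOrderAt (resolvent A) z < 0 ↔ z ∈ spectrum A := by
  have hmero := meromorphicOn_resolvent hT hΩ hz₀ hfin z hz
  rw [spectrum, Set.mem_compl_iff, ← not_le, not_iff_not, hT.mem_resolventSet_iff,
    ← tendsto_nhds_iff_meromorphicOrderAt_nonneg hmero]
  constructor
  · rintro ⟨R, hR⟩
    have hunit := eventually_mem_resolventSet hT hΩ hz₀ hfin hz
    simp only [hT.mem_resolventSet_iff] at hunit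
    have hL : Tendsto (pencil T z₀) (𝓝[≠] z) (𝓝 (pencil T z₀ z)) :=
      ((continuous_pencil T z₀).tendsto z).mono_left nhdsWithin_le_nhds
    have hc : Tendsto (fun w : ℂ => w - z₀) (𝓝[≠] z) (𝓝 (z - z₀)) :=
      ((continuous_id.sub continuous_const).tendsto z).mono_left nhdsWithin_le_nhds
    have hinv : ∀ᶠ w in 𝓝[≠] z,
        Ring.inverse (pencil T z₀ w) = 1 + (w - z₀) • resolvent A w := by
      filter_upwards [hunit] with w hw
      have h1 := Ring.mul_inverse_cancel _ hw
      rw [hT.resolvent_eq, ← smul_mul_assoc, ← h1, ← add_mul]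
      simp [pencil]
    have hlim : Tendsto (fun w => Ring.inverse (pencil T z₀ w)) (𝓝[≠] z)
        (𝓝 (1 + (z - z₀) • R)) :=
      (tendsto_const_nhds.add (hc.smul hR)).congr' (hinv.mono fun w hw => hw.symm)
    refine ⟨⟨pencil T z₀ z, 1 + (z - z₀) • R, ?_, ?_⟩, rfl⟩
    · exact tendsto_nhds_unique (hL.mul hlim) (tendsto_const_nhds.congr'
        (hunit.mono fun w hw => (Ring.mul_inverse_cancel _ hw).symm))
    · exact tendsto_nhds_unique (hlim.mul hL) (tendsto_const_nhds.congr'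
        (hunit.mono fun w hw => (Ring.inverse_mul_cancel _ hw).symm))
  · intro hu
    have h1 := (analyticAt_const (v := T)).mul ((analyticAt_pencil T z₀ z).ringInverse hu)
    have h2 : ContinuousAt (resolvent A) z :=
      h1.continuousAt.congr (Eventually.of_forall fun v => (hT.resolvent_eq v).symm)
    exact ⟨_, h2.tendsto.mono_left nhdsWithin_le_nhds⟩

theorem mem_spectrum_iff_isEigenvalue (hT : IsResolventAt A z₀ T)
    (hz : IsUnitAddFiniteRank (pencil T z₀ z)) : z ∈ spectrum A ↔ IsEigenvalue A z := by
  rw [spectrum, Set.mem_compl_iff, hT.mem_resolventSet_iff, hT.isEigenvalue_iff, not_iff_not]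
  exact ⟨fun h => (ContinuousLinearMap.isUnit_iff_bijective.mp h).1, hz.isUnit_of_injective⟩

/-- The kernels of L(z)^k stop growing at the exponent m that regularizes L(w)⁻¹, and L(z)^m is
again invertible plus finite rank. -/
theorem finiteDimensional_rootSpace (hT : IsResolventAt A z₀ T) (hΩ : IsPreconnected Ω)
    (hz₀ : z₀ ∈ Ω) (hfin : ∀ w ∈ Ω, IsUnitAddFiniteRank (pencil T z₀ w)) (hz : z ∈ Ω) :
    FiniteDimensional ℂ (rootSpace A z) := by
  obtain ⟨m, hm⟩ := meromorphicAt_inverse_pencil hΩ hz₀ hfin hz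
  have hunit := eventually_mem_resolventSet hT hΩ hz₀ hfin hz
  simp only [hT.mem_resolventSet_iff] at hunit
  have := ((hfin z hz).pow m).finiteDimensional_ker
  refine Submodule.finiteDimensional_of_le (S₂ := (pencil T z₀ z ^ m).ker) (iSup_le fun k => ?_)
  exact (hT.kerPow_le z k).trans
    (ker_pencil_pow_le hm.continuousAt (hunit.mono fun w hw => ⟨hw, rfl⟩) k)

theorem mem_discreteSpectrum (hT : IsResolventAt A z₀ T) (hΩ : IsPreconnected Ω)
    (hz₀ : z₀ ∈ Ω) (hfin : ∀ w ∈ Ω, IsUnitAddFiniteRank (pencil T z₀ w)) (hz : z ∈ Ω)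
    (hzs : z ∈ spectrum A) : z ∈ discreteSpectrum A := by
  obtain ⟨m, hm⟩ := meromorphicAt_inverse_pencil hΩ hz₀ hfin hz
  have hunit := eventually_mem_resolventSet hT hΩ hz₀ hfin hz
  rw [eventually_nhdsWithin_iff] at hunit
  -- One radius serves both to isolate z in the spectrum and to keep (w - z)^m L(w)⁻¹ analytic on
  -- the closed disc.
  obtain ⟨r, hr, hball⟩ := Metric.nhds_basis_closedBall.eventually_iff.mp
    (hunit.and hm.eventually_analyticAt)
  refine ⟨hzs, r, hr, ?_, ?_⟩
  · refine Set.Subset.antisymm (fun w ⟨hw, hws⟩ => ?_)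
      (Set.singleton_subset_iff.mpr ⟨Metric.mem_closedBall_self hr.le, hzs⟩)
    by_contra hne
    exact hws ((hball hw).1 hne)
  · have := ((hfin z hz).pow m).finiteDimensional_ker
    refine Submodule.finiteDimensional_of_le (hT.range_rieszProjection_le hr (m := m)
      (fun w hw => (hball hw).2.differentiableAt.differentiableWithinAt) fun w hw => ⟨?_, rfl⟩)
    exact (hT.mem_resolventSet_iff w).mp ((hball (Metric.sphere_subset_closedBall hw)).1
      (Metric.ne_of_mem_sphere hw hr.ne'))

end AnalyticFredholm

end UnboundedOp

/-! ### Bounded multiplication operators on L² -/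

section Multiplication

variable {n : ℕ}

/-- Multiplication by an essentially bounded function, as a bounded operator on `L²(ℝⁿ)`. -/
def mulCLM (a : EuclideanSpace ℝ (Fin n) → ℂ) (ha : MemLp a ∞ volume) : L2 n →L[ℂ] L2 n :=
  (ContinuousLinearMap.mul ℂ ℂ).holderL volume ∞ 2 2 (ha.toLp a)

theorem coeFn_mulCLM (a : EuclideanSpace ℝ (Fin n) → ℂ) (ha : MemLp a ∞ volume) (f : L2 n) :
    mulCLM a ha f =ᵐ[volume] fun x => a x * f x := by
  have h := (ContinuousLinearMap.mul ℂ ℂ).coeFn_holder (r := 2) (ha.toLp a) f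
  filter_upwards [h, ha.coeFn_toLp] with x hx hax
  rw [← hax]
  exact hx

theorem mulCLM_eq_iff {a : EuclideanSpace ℝ (Fin n) → ℂ} {ha : MemLp a ∞ volume} {f g : L2 n} :
    mulCLM a ha f = g ↔ ∀ᵐ x, g x = a x * f x := by
  constructor
  · rintro rfl
    exact coeFn_mulCLM a ha f
  · intro h
    refine Lp.ext ?_
    filter_upwards [h, coeFn_mulCLM a ha f] with x hx hx'
    rw [hx, hx']

theorem norm_mulCLM_le {a : EuclideanSpace ℝ (Fin n) → ℂ} (ha : MemLp a ∞ volume) {C : ℝ}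
    (hC : 0 ≤ C) (haC : ∀ᵐ x, ‖a x‖ ≤ C) : ‖mulCLM a ha‖ ≤ C := by
  refine ContinuousLinearMap.opNorm_le_bound _ hC fun f => Lp.norm_le_mul_norm_of_ae_le_mul ?_
  filter_upwards [haC, coeFn_mulCLM a ha f] with x hx hx'
  rw [hx', norm_mul]
  gcongr

theorem mulCLM_mul {a b : EuclideanSpace ℝ (Fin n) → ℂ} (ha : MemLp a ∞ volume)
    (hb : MemLp b ∞ volume) (hab : MemLp (fun x => a x * b x) ∞ volume) :
    mulCLM (fun x => a x * b x) hab = mulCLM a ha ∘L mulCLM b hb := by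
  ext1 f
  rw [mulCLM_eq_iff]
  filter_upwards [coeFn_mulCLM a ha (mulCLM b hb f), coeFn_mulCLM b hb f] with x h1 h2
  rw [ContinuousLinearMap.comp_apply, h1, h2, mul_assoc]

theorem mulCLM_sub {a b : EuclideanSpace ℝ (Fin n) → ℂ} (ha : MemLp a ∞ volume)
    (hb : MemLp b ∞ volume) : mulCLM a ha - mulCLM b hb = mulCLM (a - b) (ha.sub hb) := by
  ext1 f
  refine (mulCLM_eq_iff.mpr ?_).symm
  filter_upwards [coeFn_mulCLM a ha f, coeFn_mulCLM b hb f,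
    Lp.coeFn_sub (mulCLM a ha f) (mulCLM b hb f)] with x h1 h2 h3
  rw [sub_apply, h3, Pi.sub_apply, h1, h2, Pi.sub_apply, sub_mul]

theorem mulL2_eq_mulCLM {U : EuclideanSpace ℝ (Fin n) → ℝ} (hU : MemLp U ∞ volume) (f : L2 n) :
    mulL2 U hU f = mulCLM (fun x => (U x : ℂ)) hU.ofReal f := by
  refine (mulCLM_eq_iff.mpr ?_).symm
  exact (memLp_mul_L2 hU f).coeFn_toLp

end Multiplication

/-! ### The Laplacian on the Fourier side -/

section Fourier

variable {n : ℕ}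

/-- The Fourier transform on `L²(ℝⁿ)`, as a bounded operator. -/
abbrev fourierL2 (n : ℕ) : L2 n ≃L[ℂ] L2 n :=
  (Lp.fourierTransformₗᵢ (EuclideanSpace ℝ (Fin n)) ℂ).toContinuousLinearEquiv

theorem fourierL2_apply (f : L2 n) : fourierL2 n f = 𝓕 f := rfl

theorem fourierL2_symm_apply (f : L2 n) : (fourierL2 n).symm f = 𝓕⁻ f := rfl

theorem norm_fourierL2 (f : L2 n) : ‖fourierL2 n f‖ = ‖f‖ :=
  (Lp.fourierTransformₗᵢ (EuclideanSpace ℝ (Fin n)) ℂ).norm_map f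

theorem norm_fourierL2_symm (f : L2 n) : ‖(fourierL2 n).symm f‖ = ‖f‖ :=
  (Lp.fourierTransformₗᵢ (EuclideanSpace ℝ (Fin n)) ℂ).symm.norm_map f

theorem smulLeftCLM_toTemperedDistribution_eq {h : EuclideanSpace ℝ (Fin n) → ℂ}
    (hh : h.HasTemperateGrowth) {f g : L2 n} (hfg : ∀ᵐ ξ, g ξ = h ξ * f ξ) :
    TemperedDistribution.smulLeftCLM ℂ h (f : 𝓢'(EuclideanSpace ℝ (Fin n), ℂ)) =
      (g : 𝓢'(EuclideanSpace ℝ (Fin n), ℂ)) := by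
  ext u
  simp only [Lp.toTemperedDistribution_apply, TemperedDistribution.smulLeftCLM_apply_apply]
  refine integral_congr_ae ?_
  filter_upwards [hfg] with ξ hξ
  rw [hξ, SchwartzMap.smulLeftCLM_apply_apply hh]
  simp only [smul_eq_mul]
  ring

theorem fourier_laplacian_eq (f : 𝓢'(EuclideanSpace ℝ (Fin n), ℂ)) :
    𝓕 (Δ f) = TemperedDistribution.smulLeftCLM ℂ
      (fun ξ => ((-(2 * Real.pi) ^ 2 * ‖ξ‖ ^ 2 : ℝ) : ℂ)) (𝓕 f) := by
  have hg : (fun ξ : EuclideanSpace ℝ (Fin n) =>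
      ((‖ξ‖ ^ 2 : ℝ) : ℂ)).HasTemperateGrowth := by fun_prop
  have h2 : (fun ξ : EuclideanSpace ℝ (Fin n) => ((-(2 * Real.pi) ^ 2 * ‖ξ‖ ^ 2 : ℝ) : ℂ)) =
      ((-(2 * Real.pi) ^ 2 : ℝ) : ℂ) • fun ξ => ((‖ξ‖ ^ 2 : ℝ) : ℂ) := by
    ext ξ
    simp
  rw [TemperedDistribution.laplacian_eq_fourierMultiplierCLM, h2,
    TemperedDistribution.smulLeftCLM_smul hg, ← Complex.coe_smul, FourierTransform.fourier_smul,
    TemperedDistribution.fourierMultiplierCLM_apply, FourierTransform.fourier_fourierInv_eq]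
  rfl

/-- The Fourier transform of `Δ f` is `-4π²|ξ|²` times that of `f`. -/
theorem fourier_laplacianH2 (f : sobolevH2 n) :
    ∀ᵐ ξ, fourierL2 n (laplacianH2 n f) ξ =
      ((-(2 * Real.pi) ^ 2 * ‖ξ‖ ^ 2 : ℝ) : ℂ) * fourierL2 n (f : L2 n) ξ := by
  set h : EuclideanSpace ℝ (Fin n) → ℂ := fun ξ => ((-(2 * Real.pi) ^ 2 * ‖ξ‖ ^ 2 : ℝ) : ℂ)
    with hh
  -- The symbol h is unbounded on L². The weight w = (1 + |ξ|²)⁻¹ makes both w and wh bounded, so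
  -- the identity can be compared between L² functions inside the tempered distributions; w never
  -- vanishes and is cancelled at the end.
  set w : EuclideanSpace ℝ (Fin n) → ℂ := fun ξ => (((1 + ‖ξ‖ ^ 2) ^ (-1 : ℝ) : ℝ) : ℂ) with hw
  have hht : h.HasTemperateGrowth := by fun_prop
  have hwt : w.HasTemperateGrowth := by fun_prop
  have hwv : ∀ ξ, w ξ = (((1 + ‖ξ‖ ^ 2)⁻¹ : ℝ) : ℂ) := fun ξ => by
    simp only [hw, Real.rpow_neg_one]
  have hwtop : MemLp w ∞ volume := by
    refine memLp_top_of_bound hwt.1.continuous.aestronglyMeasurable 1 (ae_of_all _ fun ξ => ?_)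
    rw [hwv, Complex.norm_real, Real.norm_of_nonneg (by positivity)]
    exact inv_le_one_of_one_le₀ (by nlinarith [sq_nonneg ‖ξ‖])
  have hwhtop : MemLp (fun ξ => w ξ * h ξ) ∞ volume := by
    refine memLp_top_of_bound (hwt.1.continuous.mul hht.1.continuous).aestronglyMeasurable
      ((2 * Real.pi) ^ 2) (ae_of_all _ fun ξ => ?_)
    rw [hwv, hh, norm_mul, Complex.norm_real, Complex.norm_real, Real.norm_of_nonneg
      (by positivity), Real.norm_eq_abs, abs_mul, abs_neg, abs_of_nonneg (by positivity),
      abs_of_nonneg (by positivity), inv_mul_le_iff₀ (by positivity)]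
    nlinarith [sq_nonneg ‖ξ‖, sq_nonneg (2 * Real.pi)]
  have hkey : mulCLM w hwtop (fourierL2 n (laplacianH2 n f)) =
      mulCLM (fun ξ => w ξ * h ξ) hwhtop (fourierL2 n (f : L2 n)) := by
    apply L2.toTemperedDistribution_injective n
    simp only [Lp.toTemperedDistributionCLM_apply]
    rw [← smulLeftCLM_toTemperedDistribution_eq hwt (coeFn_mulCLM w hwtop _),
      ← smulLeftCLM_toTemperedDistribution_eq (hwt.mul hht) (coeFn_mulCLM _ hwhtop _)]
    simp only [fourierL2_apply]
    rw [← Lp.fourier_toTemperedDistribution_eq, ← Lp.fourier_toTemperedDistribution_eq,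
      laplacianH2_spec, fourier_laplacian_eq,
      TemperedDistribution.smulLeftCLM_smulLeftCLM_apply hht hwt, mul_comm]
  filter_upwards [coeFn_mulCLM w hwtop (fourierL2 n (laplacianH2 n f)),
    coeFn_mulCLM _ hwhtop (fourierL2 n (f : L2 n))] with ξ h1 h2
  rw [hkey, h2, mul_assoc] at h1
  refine (mul_left_cancel₀ ?_ h1).symm
  rw [hwv]
  exact_mod_cast (by positivity : (1 + ‖ξ‖ ^ 2)⁻¹ ≠ 0)

theorem mem_sobolevH2_of_fourier {f g : L2 n}
    (hfg : ∀ᵐ ξ, fourierL2 n g ξ = ((-(2 * Real.pi) ^ 2 * ‖ξ‖ ^ 2 : ℝ) : ℂ) * fourierL2 n f ξ) :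
    ∃ hf : f ∈ sobolevH2 n, laplacianH2 n ⟨f, hf⟩ = g := by
  have hf : f ∈ sobolevH2 n := by
    -- The L² witness equals (1 + |ξ|²) times the Fourier transform of f, because that of g is
    -- -4π²|ξ|² times it.
    refine TemperedDistribution.memSobolev_iff_exists_smulLeftCLM_fourier.mpr
      ⟨fourierL2 n f - (((2 * Real.pi) ^ 2)⁻¹ : ℂ) • fourierL2 n g, ?_⟩
    rw [Lp.fourier_toTemperedDistribution_eq]
    refine smulLeftCLM_toTemperedDistribution_eq (by fun_prop) ?_
    filter_upwards [hfg, Lp.coeFn_sub (fourierL2 n f) ((((2 * Real.pi) ^ 2)⁻¹ : ℂ) • fourierL2 n g),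
      Lp.coeFn_smul (((2 * Real.pi) ^ 2)⁻¹ : ℂ) (fourierL2 n g)] with ξ h1 h2 h3
    rw [h2, Pi.sub_apply, h3, Pi.smul_apply, h1, fourierL2_apply]
    have : (Real.pi : ℂ) ≠ 0 := by exact_mod_cast Real.pi_ne_zero
    norm_num
    field_simp
  refine ⟨hf, ?_⟩
  apply (fourierL2 n).injective
  refine Lp.ext ?_
  filter_upwards [hfg, fourier_laplacianH2 ⟨f, hf⟩] with ξ h1 h2
  rw [h1, h2]

end Fourier

/-! ### Finite-rank approximation of potential times Fourier multiplier -/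

section Compactness

variable {n : ℕ}

/-- The operator `f ↦ (x ↦ v(x) f)` defined by a square integrable function `v` with values in the
dual space. -/
def dualIntegralOperator {H α : Type*} [NormedAddCommGroup H] [NormedSpace ℂ H]
    {_ : MeasurableSpace α} {ν : Measure α} :
    Lp (H →L[ℂ] ℂ) 2 ν →L[ℂ] H →L[ℂ] Lp ℂ 2 ν :=
  (ContinuousLinearMap.compLpL₂ 2 ν (ContinuousLinearMap.id ℂ (H →L[ℂ] ℂ)).flip).flip

theorem coeFn_dualIntegralOperator {H α : Type*} [NormedAddCommGroup H] [NormedSpace ℂ H]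
    {_ : MeasurableSpace α} {ν : Measure α} (v : Lp (H →L[ℂ] ℂ) 2 ν) (f : H) :
    dualIntegralOperator v f =ᵐ[ν] fun x => v x f :=
  ContinuousLinearMap.coeFn_compLpL ((ContinuousLinearMap.id ℂ (H →L[ℂ] ℂ)).flip f) v

/-- This plays the role of compactness of Hilbert–Schmidt operators: the indicator of a set s times
a functional c gives the operator f ↦ c(f)·1ₛ of rank at most one, such v span a dense subspace of
L², and the operator depends continuously on v. -/
theorem dualIntegralOperator_mem_approximableOperators {H α : Type*} [NormedAddCommGroup H]
    [NormedSpace ℂ H] {_ : MeasurableSpace α} {ν : Measure α} (v : Lp (H →L[ℂ] ℂ) 2 ν) :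
    dualIntegralOperator v ∈ approximableOperators H (Lp ℂ 2 ν) := by
  induction v using Lp.induction (ENNReal.ofNat_ne_top : (2 : ℝ≥0∞) ≠ ∞) with
  | @indicatorConst c s hs hμs =>
    refine finiteRankOperators_le_approximableOperators (mem_finiteRankOperators.mpr ?_)
    have h : dualIntegralOperator (Lp.simpleFunc.indicatorConst 2 hs hμs.ne c : Lp _ 2 ν) =
        (LinearMap.toContinuousLinearMap (LinearMap.toSpanSingleton ℂ (Lp ℂ 2 ν)
          (indicatorConstLp 2 hs hμs.ne 1))) ∘L c := by
      ext1 f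
      refine Lp.ext ?_
      rw [Lp.simpleFunc.coe_indicatorConst]
      filter_upwards [coeFn_dualIntegralOperator (indicatorConstLp 2 hs hμs.ne c) f,
        indicatorConstLp_coeFn (p := 2) (hs := hs) (hμs := hμs.ne) (c := c),
        indicatorConstLp_coeFn (p := 2) (hs := hs) (hμs := hμs.ne) (c := (1 : ℂ)),
        Lp.coeFn_smul (c f) (indicatorConstLp 2 hs hμs.ne (1 : ℂ))] with x h1 h2 h3 h4
      rw [h1, h2]
      refine Eq.trans ?_ h4.symm
      rw [Pi.smul_apply, h3]
      by_cases hx : x ∈ s <;> simp [hx]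
    rw [h]
    exact LinearMap.HasFiniteRange.comp_left LinearMap.HasFiniteRange.of_isNoetherian_rng _
  | add hf hg _ h1 h2 =>
    rw [map_add]
    exact add_mem h1 h2
  | isClosed => exact isClosed_approximableOperators.preimage dualIntegralOperator.continuous

theorem norm_fourierChar_sub_le (s t : ℝ) :
    ‖(Real.fourierChar s : ℂ) - Real.fourierChar t‖ ≤ 2 * Real.pi * |s - t| := by
  have h1 : (Real.fourierChar s : ℂ) - Real.fourierChar t =
      Real.fourierChar t * (Complex.exp (Complex.I * (2 * Real.pi * (s - t) : ℝ)) - 1) := by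
    rw [mul_sub, mul_one, Real.fourierChar_apply, Real.fourierChar_apply, ← Complex.exp_add]
    congr 2
    push_cast
    ring
  rw [h1, norm_mul, Circle.norm_coe, one_mul]
  refine Real.norm_exp_I_mul_ofReal_sub_one_le.trans (le_of_eq ?_)
  rw [Real.norm_eq_abs, abs_mul, abs_of_pos Real.two_pi_pos]

variable {χ : EuclideanSpace ℝ (Fin n) → ℂ}

theorem memLp_fourierChar_mul (hχ : Continuous χ) (hχc : HasCompactSupport χ)
    (x : EuclideanSpace ℝ (Fin n)) :
    MemLp (fun ξ => (Real.fourierChar (-⟪ξ, x⟫) : ℂ) * χ ξ) 2 volume := by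
  refine Continuous.memLp_of_hasCompactSupport ?_ hχc.mul_left
  have h : Continuous fun c : Circle => (c : ℂ) := by fun_prop
  exact (h.comp (Real.continuous_fourierChar.comp (by fun_prop))).mul hχ

/-- The function `ξ ↦ e^{-2πi⟨ξ, x⟩} χ(ξ)`, as an element of `L²`. -/
def truncatedCharacter (hχ : Continuous χ) (hχc : HasCompactSupport χ)
    (x : EuclideanSpace ℝ (Fin n)) : L2 n :=
  (memLp_fourierChar_mul hχ hχc x).toLp _

theorem norm_truncatedCharacter_le (hχ : Continuous χ) (hχc : HasCompactSupport χ)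
    (x : EuclideanSpace ℝ (Fin n)) :
    ‖truncatedCharacter hχ hχc x‖ ≤ ‖truncatedCharacter hχ hχc 0‖ := by
  refine Lp.norm_le_norm_of_ae_le ?_
  filter_upwards [(memLp_fourierChar_mul hχ hχc x).coeFn_toLp,
    (memLp_fourierChar_mul hχ hχc 0).coeFn_toLp] with ξ h1 h2
  rw [truncatedCharacter, truncatedCharacter, h1, h2]
  simp [Circle.norm_coe]

/-- On the compact support of χ the frequencies are bounded, so the characters are Lipschitz in x.
Continuity supplies the strong measurability of the functionals they define. -/
theorem continuous_truncatedCharacter (hχ : Continuous χ) (hχc : HasCompactSupport χ) :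
    Continuous (truncatedCharacter hχ hχc) := by
  obtain ⟨R, hR⟩ := hχc.isCompact.isBounded.exists_norm_le
  set g := truncatedCharacter hχ hχc 0 with hg
  -- The bound R may be negative when the support is empty, hence the maximum.
  have hR0 : 0 ≤ max R 0 := le_max_right _ _
  have hLip : ∀ x y, ‖truncatedCharacter hχ hχc x - truncatedCharacter hχ hχc y‖ ≤
      (2 * Real.pi * (max R 0 * ‖x - y‖)) * ‖g‖ := by
    intro x y
    refine Lp.norm_le_mul_norm_of_ae_le_mul ?_
    filter_upwards [(memLp_fourierChar_mul hχ hχc x).coeFn_toLp,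
      (memLp_fourierChar_mul hχ hχc y).coeFn_toLp, (memLp_fourierChar_mul hχ hχc 0).coeFn_toLp,
      Lp.coeFn_sub (truncatedCharacter hχ hχc x) (truncatedCharacter hχ hχc y)] with ξ h1 h2 h3 h4
    rw [h4, Pi.sub_apply, hg, truncatedCharacter, truncatedCharacter, truncatedCharacter, h1, h2,
      h3, ← sub_mul, norm_mul, norm_mul, Circle.norm_coe, one_mul]
    by_cases hξ : ξ ∈ tsupport χ
    · gcongr
      refine (norm_fourierChar_sub_le _ _).trans ?_
      gcongr
      have : -⟪ξ, x⟫ - -⟪ξ, y⟫ = -⟪ξ, x - y⟫ := by rw [inner_sub_right]; ring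
      rw [this, abs_neg]
      refine (abs_real_inner_le_norm _ _).trans ?_
      gcongr
      exact (hR ξ hξ).trans (le_max_left _ _)
    · rw [image_eq_zero_of_notMem_tsupport hξ]
      simp
  refine (LipschitzWith.of_dist_le_mul
    (K := ⟨2 * Real.pi * max R 0 * ‖g‖, by positivity⟩) fun x y => ?_).continuous
  rw [dist_eq_norm, dist_eq_norm]
  refine (hLip x y).trans (le_of_eq ?_)
  change 2 * Real.pi * (max R 0 * ‖x - y‖) * ‖g‖ = 2 * Real.pi * max R 0 * ‖g‖ * ‖x - y‖
  ring

theorem inner_truncatedCharacter (hχ : Continuous χ) (hχc : HasCompactSupport χ)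
    (hχr : ∀ ξ, starRingEnd ℂ (χ ξ) = χ ξ) (x : EuclideanSpace ℝ (Fin n)) (f : L2 n) :
    inner ℂ (truncatedCharacter hχ hχc x) f =
      ∫ ξ, Real.fourierChar ⟪ξ, x⟫ • (χ ξ * f ξ) := by
  rw [L2.inner_def]
  refine integral_congr_ae ?_
  filter_upwards [(memLp_fourierChar_mul hχ hχc x).coeFn_toLp] with ξ h1
  rw [truncatedCharacter, h1, RCLike.inner_apply, map_mul, hχr, Circle.smul_def, smul_eq_mul,
    AddChar.map_neg_eq_inv, Circle.coe_inv_eq_conj, Complex.conj_conj]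
  ring

/-- The operator sends f to x ↦ c(x)⟨eₓ, f⟩ with eₓ the truncated character. The norms of the eₓ are
uniformly bounded and c is in L², so x ↦ c(x)⟨eₓ, ·⟩ is a square integrable family of functionals.
-/
theorem mulCLM_comp_fourierInv_comp_mulCLM_mem (hχ : ContDiff ℝ (⊤ : ℕ∞) χ)
    (hχc : HasCompactSupport χ) (hχr : ∀ ξ, starRingEnd ℂ (χ ξ) = χ ξ)
    (hχtop : MemLp χ ∞ volume) {c : EuclideanSpace ℝ (Fin n) → ℂ} (hc : MemLp c ∞ volume)
    (hc2 : MemLp c 2 volume) :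
    mulCLM c hc ∘L ((fourierL2 n).symm : L2 n →L[ℂ] L2 n) ∘L mulCLM χ hχtop ∈
      approximableOperators (L2 n) (L2 n) := by
  set ℓ : EuclideanSpace ℝ (Fin n) → (L2 n →L[ℂ] ℂ) :=
    fun x => innerSL ℂ (truncatedCharacter hχ.continuous hχc x) with hℓ
  have hℓc : Continuous ℓ :=
    (innerSL ℂ).continuous.comp (continuous_truncatedCharacter hχ.continuous hχc)
  have hv : MemLp (fun x => c x • ℓ x) 2 volume := by
    have hℓtop : MemLp ℓ ∞ volume := by
      refine memLp_top_of_bound hℓc.aestronglyMeasurable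
        ‖truncatedCharacter hχ.continuous hχc 0‖ (ae_of_all _ fun x => ?_)
      rw [hℓ, innerSL_apply_norm]
      exact norm_truncatedCharacter_le hχ.continuous hχc x
    exact hℓtop.smul hc2
  suffices h : mulCLM c hc ∘L ((fourierL2 n).symm : L2 n →L[ℂ] L2 n) ∘L mulCLM χ hχtop =
      dualIntegralOperator (hv.toLp _) by
    rw [h]
    exact dualIntegralOperator_mem_approximableOperators _
  have hχt : χ.HasTemperateGrowth := hχc.hasTemperateGrowth hχ
  refine ContinuousLinearMap.ext fun f => ?_
  -- By density only Schwartz functions need checking; there the smooth cutoff preserves the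
  -- Schwartz class and the inverse Fourier transform is a genuine integral.
  refine DenseRange.induction_on (SchwartzMap.denseRange_toLpCLM (F := ℂ) (p := 2)
    (μ := (volume : Measure (EuclideanSpace ℝ (Fin n)))) ENNReal.ofNat_ne_top) f
    (isClosed_eq (ContinuousLinearMap.continuous _) (ContinuousLinearMap.continuous _)) fun g => ?_
  rw [SchwartzMap.toLpCLM_apply]
  have h1 : mulCLM χ hχtop (g.toLp 2) = (SchwartzMap.smulLeftCLM ℂ χ g).toLp 2 := by
    rw [mulCLM_eq_iff]
    filter_upwards [g.coeFn_toLp 2 volume,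
      (SchwartzMap.smulLeftCLM ℂ χ g).coeFn_toLp 2 volume] with ξ h1 h2
    rw [h1, h2, SchwartzMap.smulLeftCLM_apply_apply hχt, smul_eq_mul]
  have h2 : (fourierL2 n).symm (mulCLM χ hχtop (g.toLp 2)) =
      (𝓕⁻ (SchwartzMap.smulLeftCLM ℂ χ g)).toLp 2 := by
    rw [h1, fourierL2_symm_apply, SchwartzMap.toLp_fourierInv_eq]
  simp only [ContinuousLinearMap.comp_apply, ContinuousLinearEquiv.coe_coe]
  rw [h2, mulCLM_eq_iff]
  filter_upwards [coeFn_dualIntegralOperator (hv.toLp _) (g.toLp 2 volume), hv.coeFn_toLp,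
    (𝓕⁻ (SchwartzMap.smulLeftCLM ℂ χ g)).coeFn_toLp 2 volume] with x h3 h4 h5
  rw [h3, h4, h5, smul_apply, smul_eq_mul]
  simp only [hℓ, innerSL_apply_apply]
  rw [inner_truncatedCharacter hχ.continuous hχc hχr, SchwartzMap.fourierInv_coe, Real.fourierInv_eq]
  congr 1
  refine integral_congr_ae ?_
  filter_upwards [g.coeFn_toLp 2 volume] with ξ hξ
  rw [hξ, SchwartzMap.smulLeftCLM_apply_apply hχt, smul_eq_mul]

/-- Restrict a to a compact set off which |a| ≤ ε almost everywhere; a bounded function on a set of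
finite measure is square integrable. -/
theorem exists_norm_mulCLM_sub_le {a : EuclideanSpace ℝ (Fin n) → ℂ} (ha : MemLp a ∞ volume)
    (ha0 : Tendsto a (cocompact (EuclideanSpace ℝ (Fin n)) ⊓ ae volume) (𝓝 0)) {ε : ℝ}
    (hε : 0 < ε) : ∃ (c : EuclideanSpace ℝ (Fin n) → ℂ) (hc : MemLp c ∞ volume),
      MemLp c 2 volume ∧ ‖mulCLM a ha - mulCLM c hc‖ ≤ ε := by
  have h1 : ∀ᶠ x in cocompact (EuclideanSpace ℝ (Fin n)) ⊓ ae volume, ‖a x‖ ≤ ε := by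
    filter_upwards [ha0 (Metric.ball_mem_nhds 0 hε)] with x hx
    exact (mem_ball_zero_iff.mp hx).le
  obtain ⟨t, ht, u, hu, htu⟩ := eventually_inf.mp h1
  obtain ⟨K, hK, hKt⟩ := mem_cocompact.mp ht
  have hc : MemLp (K.indicator a) ∞ volume := ha.indicator hK.measurableSet
  refine ⟨_, hc, ?_, ?_⟩
  · have : IsFiniteMeasure (volume.restrict K) := ⟨by
      rw [Measure.restrict_apply_univ]; exact hK.measure_lt_top⟩
    exact (memLp_indicator_iff_restrict hK.measurableSet).mpr
      ((ha.restrict K).mono_exponent le_top)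
  · rw [mulCLM_sub]
    refine norm_mulCLM_le _ hε.le ?_
    filter_upwards [hu] with x hx
    by_cases hxK : x ∈ K
    · simp [hxK, hε.le]
    · simpa [hxK] using htu x ⟨hKt hxK, hx⟩

theorem exists_smooth_cutoff {s : EuclideanSpace ℝ (Fin n) → ℂ} (hs : MemLp s ∞ volume)
    (hs0 : Tendsto s (cocompact (EuclideanSpace ℝ (Fin n))) (𝓝 0)) {ε : ℝ} (hε : 0 < ε) :
    ∃ (χ : EuclideanSpace ℝ (Fin n) → ℂ) (hχtop : MemLp χ ∞ volume),
      ContDiff ℝ (⊤ : ℕ∞) χ ∧ HasCompactSupport χ ∧ (∀ ξ, starRingEnd ℂ (χ ξ) = χ ξ) ∧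
      ‖mulCLM s hs - mulCLM χ hχtop ∘L mulCLM s hs‖ ≤ ε := by
  have h1 : ∀ᶠ ξ in cocompact (EuclideanSpace ℝ (Fin n)), ‖s ξ‖ ≤ ε := by
    filter_upwards [hs0 (Metric.ball_mem_nhds 0 hε)] with x hx
    exact (mem_ball_zero_iff.mp hx).le
  rw [← Metric.cobounded_eq_cocompact] at h1
  obtain ⟨R, -, hR⟩ := (Metric.hasBasis_cobounded_compl_closedBall
    (0 : EuclideanSpace ℝ (Fin n))).eventually_iff.mp h1
  -- A bump needs a positive inner radius, while R may not be positive.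
  obtain ⟨b, hb⟩ : ∃ b : ContDiffBump (0 : EuclideanSpace ℝ (Fin n)), b.rIn = max R 1 :=
    ⟨⟨max R 1, max R 1 + 1, by positivity, by linarith⟩, rfl⟩
  have hχ : ContDiff ℝ (⊤ : ℕ∞) (fun ξ => ((b ξ : ℝ) : ℂ)) :=
    Complex.ofRealCLM.contDiff.comp b.contDiff
  have hχc : HasCompactSupport (fun ξ => ((b ξ : ℝ) : ℂ)) :=
    b.hasCompactSupport.comp_left Complex.ofReal_zero
  have hχtop : MemLp (fun ξ => ((b ξ : ℝ) : ℂ)) ∞ volume :=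
    hχ.continuous.memLp_of_hasCompactSupport hχc
  refine ⟨_, hχtop, hχ, hχc, fun ξ => Complex.conj_ofReal _, ?_⟩
  have hprod : MemLp (fun ξ => ((b ξ : ℝ) : ℂ) * s ξ) ∞ volume := hs.mul hχtop
  rw [← mulCLM_mul hχtop hs hprod, mulCLM_sub]
  refine norm_mulCLM_le _ hε.le (ae_of_all _ fun ξ => ?_)
  have h2 : (s - fun ξ => ((b ξ : ℝ) : ℂ) * s ξ) ξ = ((1 - b ξ : ℝ) : ℂ) * s ξ := by
    simp [sub_mul]
  rw [h2, norm_mul, Complex.norm_real, Real.norm_of_nonneg (by linarith [b.le_one (x := ξ)])]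
  by_cases hξ : ξ ∈ Metric.closedBall 0 R
  · rw [b.one_of_mem_closedBall
      (Metric.closedBall_subset_closedBall ((le_max_left R 1).trans hb.ge) hξ)]
    simp [hε.le]
  · calc (1 - b ξ) * ‖s ξ‖ ≤ 1 * ‖s ξ‖ := by
          gcongr
          linarith [b.nonneg (x := ξ)]
      _ ≤ ε := by rw [one_mul]; exact hR hξ

theorem mem_approximableOperators_of_forall_exists {X Y : Type*} [NormedAddCommGroup X]
    [NormedSpace ℂ X] [NormedAddCommGroup Y] [NormedSpace ℂ Y] {K : X →L[ℂ] Y} {C : ℝ}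
    (hK : ∀ ε > 0, ∃ K' ∈ approximableOperators X Y, ‖K - K'‖ ≤ C * ε) :
    K ∈ approximableOperators X Y := by
  refine isClosed_approximableOperators.closure_subset (Metric.mem_closure_iff.mpr fun ε hε => ?_)
  obtain ⟨K', hK', hKK'⟩ := hK (ε / (|C| + 1)) (by positivity)
  refine ⟨K', hK', ?_⟩
  rw [dist_eq_norm]
  refine hKK'.trans_lt ?_
  calc C * (ε / (|C| + 1)) ≤ |C| * (ε / (|C| + 1)) := by gcongr; exact le_abs_self C
    _ = |C| / (|C| + 1) * ε := by ring
    _ < 1 * ε := by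
        gcongr
        rw [div_lt_one (by positivity)]
        linarith
    _ = ε := one_mul ε

/-- Multiplication by a potential that vanishes at infinity, composed with a Fourier multiplier
whose symbol vanishes at infinity, is a norm limit of operators of finite rank. -/
theorem mulCLM_comp_fourierMultiplier_mem {a s : EuclideanSpace ℝ (Fin n) → ℂ}
    (ha : MemLp a ∞ volume) (hs : MemLp s ∞ volume)
    (ha0 : Tendsto a (cocompact (EuclideanSpace ℝ (Fin n)) ⊓ ae volume) (𝓝 0))
    (hs0 : Tendsto s (cocompact (EuclideanSpace ℝ (Fin n))) (𝓝 0)) :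
    mulCLM a ha ∘L ((fourierL2 n).symm : L2 n →L[ℂ] L2 n) ∘L mulCLM s hs ∈
      approximableOperators (L2 n) (L2 n) := by
  generalize hI : ((fourierL2 n).symm : L2 n →L[ℂ] L2 n) = I
  -- Cut off in frequency first, with the potential already square integrable; the truncation of a
  -- in space follows. Each error is multiplied by the norm of a fixed operator.
  have hstep : ∀ (c : EuclideanSpace ℝ (Fin n) → ℂ) (hc : MemLp c ∞ volume), MemLp c 2 volume →
      mulCLM c hc ∘L I ∘L mulCLM s hs ∈ approximableOperators (L2 n) (L2 n) := by
    intro c hc hc2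
    refine mem_approximableOperators_of_forall_exists (C := ‖mulCLM c hc ∘L I‖) fun ε hε => ?_
    obtain ⟨χ, hχtop, hχ, hχc, hχr, hχs⟩ := exists_smooth_cutoff hs hs0 hε
    have hmem := mulCLM_comp_fourierInv_comp_mulCLM_mem hχ hχc hχr hχtop hc hc2
    rw [hI] at hmem
    refine ⟨_, comp_mem_approximableOperators_right hmem (mulCLM s hs), ?_⟩
    have h1 : mulCLM c hc ∘L I ∘L mulCLM s hs -
        (mulCLM c hc ∘L I ∘L mulCLM χ hχtop) ∘L mulCLM s hs =
        (mulCLM c hc ∘L I) ∘L (mulCLM s hs - mulCLM χ hχtop ∘L mulCLM s hs) := by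
      simp only [ContinuousLinearMap.comp_sub, ContinuousLinearMap.comp_assoc]
    rw [h1]
    refine (ContinuousLinearMap.opNorm_comp_le _ _).trans ?_
    gcongr
  refine mem_approximableOperators_of_forall_exists (C := ‖I ∘L mulCLM s hs‖) fun ε hε => ?_
  obtain ⟨c, hc, hc2, hca⟩ := exists_norm_mulCLM_sub_le ha ha0 hε
  refine ⟨_, hstep c hc hc2, ?_⟩
  rw [← ContinuousLinearMap.sub_comp, mul_comm]
  refine (ContinuousLinearMap.opNorm_comp_le _ _).trans ?_
  gcongr

end Compactness

/-! ### The scalar operator H: resolvent and approximate eigenvectors -/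

section Scalar

variable {n : ℕ} {μ : ℝ}

/-- The symbol `-2π²|ξ|² - μ` of the operator `H = ½Δ - μ`. -/
def scalarSymbol (n : ℕ) (μ : ℝ) (ξ : EuclideanSpace ℝ (Fin n)) : ℝ :=
  1 / 2 * (-(2 * Real.pi) ^ 2 * ‖ξ‖ ^ 2) - μ

theorem continuous_scalarSymbol (n : ℕ) (μ : ℝ) : Continuous (scalarSymbol n μ) := by
  unfold scalarSymbol
  fun_prop

theorem scalarSymbol_le (μ : ℝ) (ξ : EuclideanSpace ℝ (Fin n)) : scalarSymbol n μ ξ ≤ -μ := by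
  have : 0 ≤ (2 * Real.pi) ^ 2 * ‖ξ‖ ^ 2 := by positivity
  unfold scalarSymbol
  linarith

/-- The level sets of the symbol are spheres: they are null, which excludes eigenvalues, and
nonempty for t ≤ -μ in positive dimension, which produces approximate eigenvectors. -/
theorem scalarSymbol_eq_iff {t : ℝ} (ht : t ≤ -μ) (ξ : EuclideanSpace ℝ (Fin n)) :
    scalarSymbol n μ ξ = t ↔ ‖ξ‖ = √((-t - μ) / (2 * Real.pi ^ 2)) := by
  rw [eq_comm (b := √_), Real.sqrt_eq_iff_mul_self_eq (by
    have : 0 ≤ -t - μ := by linarith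
    positivity) (norm_nonneg ξ)]
  unfold scalarSymbol
  have := Real.pi_pos
  rw [← sq, div_eq_iff (by positivity)]
  constructor <;> intro h <;> linarith

theorem fourier_scalarH (u : sobolevH2 n) :
    ∀ᵐ ξ, fourierL2 n (scalarH n μ u) ξ = (scalarSymbol n μ ξ : ℂ) * fourierL2 n (u : L2 n) ξ := by
  have h : fourierL2 n (scalarH n μ u) =
      (1 / 2 : ℂ) • fourierL2 n (laplacianH2 n u) - (μ : ℂ) • fourierL2 n (u : L2 n) := by
    rw [← map_smul (fourierL2 n), ← map_smul (fourierL2 n), ← map_sub]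
    rfl
  rw [h]
  filter_upwards [fourier_laplacianH2 u,
    Lp.coeFn_sub ((1 / 2 : ℂ) • fourierL2 n (laplacianH2 n u)) ((μ : ℂ) • fourierL2 n (u : L2 n)),
    Lp.coeFn_smul (1 / 2 : ℂ) (fourierL2 n (laplacianH2 n u)),
    Lp.coeFn_smul (μ : ℂ) (fourierL2 n (u : L2 n))] with ξ h1 h2 h3 h4
  rw [h2, Pi.sub_apply, h3, h4, Pi.smul_apply, Pi.smul_apply, h1, scalarSymbol]
  simp only [smul_eq_mul]
  push_cast
  ring

theorem mem_sobolevH2_of_fourier_eq_scalarSymbol {u f : L2 n}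
    (h : ∀ᵐ ξ, fourierL2 n f ξ = (scalarSymbol n μ ξ : ℂ) * fourierL2 n u ξ) :
    ∃ hu : u ∈ sobolevH2 n, scalarH n μ ⟨u, hu⟩ = f := by
  -- The candidate Laplacian comes from Δ = 2(H + μ).
  obtain ⟨hu, hlap⟩ := mem_sobolevH2_of_fourier (f := u) (g := (2 : ℂ) • f + (2 * μ : ℂ) • u) (by
    rw [map_add, map_smul, map_smul]
    filter_upwards [h, Lp.coeFn_add ((2 : ℂ) • fourierL2 n f) ((2 * μ : ℂ) • fourierL2 n u),
      Lp.coeFn_smul (2 : ℂ) (fourierL2 n f), Lp.coeFn_smul (2 * μ : ℂ) (fourierL2 n u)]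
      with ξ h1 h2 h3 h4
    rw [h2, Pi.add_apply, h3, h4, Pi.smul_apply, Pi.smul_apply, h1, scalarSymbol]
    simp only [smul_eq_mul]
    push_cast
    ring)
  refine ⟨hu, ?_⟩
  change (1 / 2 : ℂ) • laplacianH2 n ⟨u, hu⟩ - (μ : ℂ) • u = f
  rw [hlap]
  module

/-- The symbol of the resolvent of `H = ½Δ - μ`. -/
def resolventSymbol (n : ℕ) (μ : ℝ) (ζ : ℂ) (ξ : EuclideanSpace ℝ (Fin n)) : ℂ :=
  ((scalarSymbol n μ ξ : ℂ) - ζ)⁻¹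

theorem scalarSymbol_sub_ne_zero {ζ : ℂ} (hζ : ∀ t : ℝ, t ≤ -μ → (t : ℂ) ≠ ζ)
    (ξ : EuclideanSpace ℝ (Fin n)) : (scalarSymbol n μ ξ : ℂ) - ζ ≠ 0 :=
  sub_ne_zero.mpr (hζ _ (scalarSymbol_le μ ξ))

theorem continuous_resolventSymbol {ζ : ℂ} (hζ : ∀ t : ℝ, t ≤ -μ → (t : ℂ) ≠ ζ) :
    Continuous (resolventSymbol n μ ζ) := by
  refine Continuous.inv₀ ?_ fun ξ => scalarSymbol_sub_ne_zero hζ ξ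
  have := continuous_scalarSymbol n μ
  fun_prop

theorem tendsto_resolventSymbol (n : ℕ) (μ : ℝ) (ζ : ℂ) :
    Tendsto (resolventSymbol n μ ζ) (cocompact (EuclideanSpace ℝ (Fin n))) (𝓝 0) := by
  refine tendsto_inv₀_cobounded.comp (tendsto_norm_atTop_iff_cobounded.mp ?_)
  have h1 : Tendsto (fun ξ : EuclideanSpace ℝ (Fin n) => ‖ξ‖ ^ 2 - |μ| - ‖ζ‖)
      (cocompact (EuclideanSpace ℝ (Fin n))) atTop := by
    simp only [sub_eq_add_neg, add_assoc]
    exact tendsto_atTop_add_const_right _ _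
      ((tendsto_pow_atTop two_ne_zero).comp (tendsto_norm_cocompact_atTop))
  refine tendsto_atTop_mono (fun ξ => ?_) h1
  refine le_trans ?_ (norm_sub_norm_le _ _)
  rw [Complex.norm_real, Real.norm_eq_abs]
  -- A crude lower bound suffices, using 2π² ≥ 1.
  have h2 : ‖ξ‖ ^ 2 - |μ| ≤ |scalarSymbol n μ ξ| := by
    refine le_trans ?_ (neg_le_abs _)
    unfold scalarSymbol
    have := neg_abs_le μ
    nlinarith [Real.pi_gt_three, sq_nonneg ‖ξ‖, mul_nonneg (sq_nonneg ‖ξ‖)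
      (by nlinarith [Real.pi_gt_three] : (0 : ℝ) ≤ 2 * Real.pi ^ 2 - 1)]
  linarith

theorem memLp_resolventSymbol {ζ : ℂ} (hζ : ∀ t : ℝ, t ≤ -μ → (t : ℂ) ≠ ζ) :
    MemLp (resolventSymbol n μ ζ) ∞ volume := by
  let s : ZeroAtInftyContinuousMap (EuclideanSpace ℝ (Fin n)) ℂ :=
    ⟨⟨resolventSymbol n μ ζ, continuous_resolventSymbol hζ⟩, tendsto_resolventSymbol n μ ζ⟩
  obtain ⟨C, hC⟩ := (ZeroAtInftyContinuousMap.isBounded_range s).exists_norm_le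
  exact memLp_top_of_bound (continuous_resolventSymbol hζ).aestronglyMeasurable C
    (ae_of_all _ fun ξ => hC _ ⟨ξ, rfl⟩)

/-- The resolvent `(H - ζ)⁻¹` of `H = ½Δ - μ`, as a Fourier multiplier. -/
def scalarResolvent (n : ℕ) (μ : ℝ) {ζ : ℂ} (hζ : ∀ t : ℝ, t ≤ -μ → (t : ℂ) ≠ ζ) :
    L2 n →L[ℂ] L2 n :=
  ((fourierL2 n).symm : L2 n →L[ℂ] L2 n) ∘L
    mulCLM (resolventSymbol n μ ζ) (memLp_resolventSymbol hζ) ∘L (fourierL2 n : L2 n →L[ℂ] L2 n)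

theorem fourier_scalarResolvent {ζ : ℂ} (hζ : ∀ t : ℝ, t ≤ -μ → (t : ℂ) ≠ ζ) (f : L2 n) :
    fourierL2 n (scalarResolvent n μ hζ f) =
      mulCLM (resolventSymbol n μ ζ) (memLp_resolventSymbol hζ) (fourierL2 n f) :=
  (fourierL2 n).apply_symm_apply _

theorem scalarH_scalarResolvent {ζ : ℂ} (hζ : ∀ t : ℝ, t ≤ -μ → (t : ℂ) ≠ ζ) (f : L2 n) :
    ∃ hu : scalarResolvent n μ hζ f ∈ sobolevH2 n,
      scalarH n μ ⟨scalarResolvent n μ hζ f, hu⟩ - ζ • scalarResolvent n μ hζ f = f := by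
  set u := scalarResolvent n μ hζ f with hu
  obtain ⟨hmem, hH⟩ := mem_sobolevH2_of_fourier_eq_scalarSymbol (μ := μ) (u := u)
    (f := f + ζ • u) (by
      rw [map_add, map_smul]
      have h0 := coeFn_mulCLM _ (memLp_resolventSymbol (n := n) hζ) (fourierL2 n f)
      rw [← fourier_scalarResolvent hζ f, ← hu] at h0
      filter_upwards [h0, Lp.coeFn_add (fourierL2 n f) (ζ • fourierL2 n u),
        Lp.coeFn_smul ζ (fourierL2 n u)] with ξ h1 h2 h3
      rw [h2, Pi.add_apply, h3, Pi.smul_apply, h1, resolventSymbol, smul_eq_mul]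
      have := scalarSymbol_sub_ne_zero hζ ξ
      field_simp
      ring)
  exact ⟨hmem, by rw [hH, add_sub_cancel_right]⟩

theorem scalarResolvent_scalarH {ζ : ℂ} (hζ : ∀ t : ℝ, t ≤ -μ → (t : ℂ) ≠ ζ) (u : sobolevH2 n) :
    scalarResolvent n μ hζ (scalarH n μ u - ζ • (u : L2 n)) = u := by
  apply (fourierL2 n).injective
  rw [fourier_scalarResolvent, mulCLM_eq_iff, map_sub, map_smul]
  filter_upwards [fourier_scalarH (μ := μ) u,
    Lp.coeFn_sub (fourierL2 n (scalarH n μ u)) (ζ • fourierL2 n (u : L2 n)),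
    Lp.coeFn_smul ζ (fourierL2 n (u : L2 n))] with ξ h1 h2 h3
  rw [h2, Pi.sub_apply, h3, Pi.smul_apply, h1, resolventSymbol, smul_eq_mul, ← sub_mul,
    inv_mul_cancel_left₀ (scalarSymbol_sub_ne_zero hζ ξ)]

/-- The symbol of H is real, so its distance to ζ is at least |Im ζ|. -/
theorem norm_scalarResolvent_le {ζ : ℂ} (hζ : ∀ t : ℝ, t ≤ -μ → (t : ℂ) ≠ ζ) (h0 : ζ.im ≠ 0) :
    ‖scalarResolvent n μ hζ‖ ≤ |ζ.im|⁻¹ := by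
  refine ContinuousLinearMap.opNorm_le_bound _ (by positivity) fun f => ?_
  rw [← norm_fourierL2 (scalarResolvent n μ hζ f), fourier_scalarResolvent, ← norm_fourierL2 f]
  refine (ContinuousLinearMap.le_opNorm _ _).trans ?_
  gcongr
  refine norm_mulCLM_le _ (by positivity) (ae_of_all _ fun ξ => ?_)
  rw [resolventSymbol, norm_inv]
  have h1 : |ζ.im| ≤ ‖(scalarSymbol n μ ξ : ℂ) - ζ‖ := by
    refine le_trans (le_of_eq ?_) (Complex.abs_im_le_norm _)
    simp
  exact inv_anti₀ (abs_pos.mpr h0) h1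

/-- The Fourier transform of u vanishes off a level set contained in a null sphere. Positive
dimension matters: in dimension 0 the sphere of radius 0 has full measure. -/
theorem eq_zero_of_scalarH_eq_smul (hn : 0 < n) {ζ : ℂ} {u : sobolevH2 n}
    (h : scalarH n μ u = ζ • (u : L2 n)) : u = 0 := by
  have : Nonempty (Fin n) := ⟨⟨0, hn⟩⟩
  have hnull : ∀ᵐ ξ : EuclideanSpace ℝ (Fin n), (scalarSymbol n μ ξ : ℂ) ≠ ζ := by
    rw [ae_iff]
    refine measure_mono_null (fun ξ hξ => ?_) (Measure.addHaar_sphere volume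
      (0 : EuclideanSpace ℝ (Fin n)) √((-ζ.re - μ) / (2 * Real.pi ^ 2)))
    simp only [Set.mem_ofPred_eq, not_not] at hξ
    have h1 : scalarSymbol n μ ξ = ζ.re := by rw [← hξ, Complex.ofReal_re]
    rw [mem_sphere_zero_iff_norm]
    exact (scalarSymbol_eq_iff (h1 ▸ scalarSymbol_le μ ξ) ξ).mp h1
  apply Subtype.ext
  apply (fourierL2 n).injective
  refine Lp.ext ?_
  rw [ZeroMemClass.coe_zero, map_zero]
  have h1 := fourier_scalarH (μ := μ) u
  rw [h, map_smul] at h1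
  filter_upwards [hnull, h1, Lp.coeFn_smul ζ (fourierL2 n (u : L2 n)),
    Lp.coeFn_zero ℂ 2 (volume : Measure (EuclideanSpace ℝ (Fin n)))] with ξ h2 h3 h4 h5
  rw [h5, Pi.zero_apply]
  rw [h4, Pi.smul_apply, smul_eq_mul] at h3
  by_contra hne
  exact h2 (mul_right_cancel₀ hne h3).symm

/-- Every `t ≤ -μ` is an approximate eigenvalue of `H = ½Δ - μ`. -/
theorem exists_norm_scalarH_sub_le (hn : 0 < n) {t : ℝ} (ht : t ≤ -μ) {ε : ℝ} (hε : 0 < ε) :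
    ∃ u : sobolevH2 n, u ≠ 0 ∧ ‖scalarH n μ u - (t : ℂ) • (u : L2 n)‖ ≤ ε * ‖(u : L2 n)‖ := by
  have : Nonempty (Fin n) := ⟨⟨0, hn⟩⟩
  obtain ⟨ξ₀, hξ₀⟩ := _root_.exists_norm_eq (EuclideanSpace ℝ (Fin n))
    (Real.sqrt_nonneg ((-t - μ) / (2 * Real.pi ^ 2)))
  have hξ₀' : scalarSymbol n μ ξ₀ = t := (scalarSymbol_eq_iff ht ξ₀).mpr hξ₀
  -- The Fourier transform of the approximate eigenvector is the indicator of S, where the symbol is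
  -- within ε of t. Openness around ξ₀ gives positive measure, and the unit ball keeps the measure
  -- finite.
  set S : Set (EuclideanSpace ℝ (Fin n)) :=
    scalarSymbol n μ ⁻¹' Metric.ball t ε ∩ Metric.ball ξ₀ 1 with hS
  have hSo : IsOpen S :=
    (Metric.isOpen_ball.preimage (continuous_scalarSymbol n μ)).inter Metric.isOpen_ball
  have hξS : ξ₀ ∈ S := ⟨by simpa [hξ₀'] using hε, Metric.mem_ball_self one_pos⟩
  have hSfin : volume S ≠ ∞ :=
    ((measure_mono Set.inter_subset_right).trans_lt measure_ball_lt_top).ne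
  have hSpos : volume S ≠ 0 := (hSo.measure_pos volume ⟨ξ₀, hξS⟩).ne'
  set v : L2 n := indicatorConstLp 2 hSo.measurableSet hSfin 1 with hv
  have hvS : ∀ᵐ ξ, v ξ = S.indicator (fun _ => 1) ξ := indicatorConstLp_coeFn
  have ha : MemLp (S.indicator fun ξ => (scalarSymbol n μ ξ : ℂ)) ∞ volume := by
    refine memLp_top_of_bound (C := |t| + ε) ?_ (ae_of_all _ fun ξ => ?_)
    · exact ((Complex.continuous_ofReal.comp
        (continuous_scalarSymbol n μ)).aestronglyMeasurable).indicator hSo.measurableSet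
    · by_cases hξ : ξ ∈ S
      · rw [Set.indicator_of_mem hξ, Complex.norm_real]
        have h1 : |scalarSymbol n μ ξ - t| < ε := hξ.1
        have h2 := abs_sub_abs_le_abs_sub (scalarSymbol n μ ξ) t
        rw [Real.norm_eq_abs]
        linarith
      · rw [Set.indicator_of_notMem hξ, norm_zero]
        positivity
  obtain ⟨hu, hH⟩ := mem_sobolevH2_of_fourier_eq_scalarSymbol (μ := μ)
    (u := (fourierL2 n).symm v) (f := (fourierL2 n).symm (mulCLM _ ha v)) (by
      rw [ContinuousLinearEquiv.apply_symm_apply, ContinuousLinearEquiv.apply_symm_apply]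
      filter_upwards [hvS, coeFn_mulCLM _ ha v] with ξ h1 h2
      rw [h2, h1]
      by_cases hξ : ξ ∈ S <;> simp [hξ])
  refine ⟨⟨_, hu⟩, fun h0 => ?_, ?_⟩
  · have h1 : v = 0 := by
      have := congrArg Subtype.val h0
      simpa using this
    have h2 : ‖v‖ = 0 := by rw [h1, norm_zero]
    rw [hv, norm_indicatorConstLp (by norm_num) (by norm_num), norm_one, one_mul] at h2
    have h3 : 0 < volume.real S := ENNReal.toReal_pos hSpos hSfin
    have := Real.rpow_pos_of_pos h3 (1 / (2 : ℝ≥0∞).toReal)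
    linarith
  · rw [hH, ← map_smul, ← map_sub, norm_fourierL2_symm, norm_fourierL2_symm]
    refine Lp.norm_le_mul_norm_of_ae_le_mul ?_
    filter_upwards [hvS, coeFn_mulCLM _ ha v, Lp.coeFn_sub (mulCLM _ ha v) ((t : ℂ) • v),
      Lp.coeFn_smul (t : ℂ) v] with ξ h1 h2 h3 h4
    rw [h3, Pi.sub_apply, h4, h2, Pi.smul_apply, smul_eq_mul, h1]
    by_cases hξ : ξ ∈ S
    · have h5 : |scalarSymbol n μ ξ - t| < ε := hξ.1
      simp only [hξ, Set.indicator_of_mem, mul_one, norm_one]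
      rw [← Complex.ofReal_sub, Complex.norm_real, Real.norm_eq_abs]
      exact h5.le
    · simp [hξ]

end Scalar

/-! ### The matrix Hamiltonian as a perturbation of diag(H, -H) -/

section Matrix

open UnboundedOp

variable {n : ℕ} {μ : ℝ} {U W : EuclideanSpace ℝ (Fin n) → ℝ}

/-- The bounded operator `(f₁, f₂) ↦ (P f₁ - Q f₂, Q f₁ - P f₂)`. -/
def blockOperator {E : Type*} [NormedAddCommGroup E] [NormedSpace ℂ E] (P Q : E →L[ℂ] E) :
    E × E →L[ℂ] E × E :=
  (P ∘L ContinuousLinearMap.fst ℂ E E - Q ∘L ContinuousLinearMap.snd ℂ E E).prod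
    (Q ∘L ContinuousLinearMap.fst ℂ E E - P ∘L ContinuousLinearMap.snd ℂ E E)

theorem blockOperator_comp_prodMap_mem {E : Type*} [NormedAddCommGroup E] [NormedSpace ℂ E]
    {P Q S₁ S₂ : E →L[ℂ] E} (hP₁ : P ∘L S₁ ∈ approximableOperators E E)
    (hQ₁ : Q ∘L S₁ ∈ approximableOperators E E) (hP₂ : P ∘L S₂ ∈ approximableOperators E E)
    (hQ₂ : Q ∘L S₂ ∈ approximableOperators E E) :
    blockOperator P Q ∘L S₁.prodMap (-S₂) ∈ approximableOperators (E × E) (E × E) := by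
  have h : blockOperator P Q ∘L S₁.prodMap (-S₂) =
      ContinuousLinearMap.inl ℂ E E ∘L ((P ∘L S₁) ∘L ContinuousLinearMap.fst ℂ E E +
        (Q ∘L S₂) ∘L ContinuousLinearMap.snd ℂ E E) +
      ContinuousLinearMap.inr ℂ E E ∘L ((Q ∘L S₁) ∘L ContinuousLinearMap.fst ℂ E E +
        (P ∘L S₂) ∘L ContinuousLinearMap.snd ℂ E E) := by
    refine ContinuousLinearMap.ext fun f => Prod.ext ?_ ?_ <;> simp [blockOperator]
  rw [h]
  exact add_mem
    (comp_mem_approximableOperators_left _ (add_mem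
      (comp_mem_approximableOperators_right hP₁ _) (comp_mem_approximableOperators_right hQ₂ _)))
    (comp_mem_approximableOperators_left _ (add_mem
      (comp_mem_approximableOperators_right hQ₁ _) (comp_mem_approximableOperators_right hP₂ _)))

/-- The bounded operator `(f₁, f₂) ↦ (U f₁ - W f₂, W f₁ - U f₂)`. -/
def potentialCLM (hU : MemLp U ∞ volume) (hW : MemLp W ∞ volume) :
    L2 n × L2 n →L[ℂ] L2 n × L2 n :=
  blockOperator (mulCLM (fun x => (U x : ℂ)) hU.ofReal) (mulCLM (fun x => (W x : ℂ)) hW.ofReal)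

/-- The operator `diag(H, -H)`, with `H = ½Δ - μ`. -/
abbrev freeHamiltonian (n : ℕ) (μ : ℝ) : (L2 n × L2 n) →ₗ.[ℂ] (L2 n × L2 n) :=
  matrixHamiltonian n μ (fun _ => 0) (fun _ => 0) MemLp.zero' MemLp.zero'

theorem mulL2_zero : mulL2 (n := n) (fun _ => 0) MemLp.zero' = 0 := by
  ext1 f
  rw [mulL2_eq_mulCLM, mulCLM_eq_iff]
  filter_upwards [Lp.coeFn_zero ℂ 2 (volume : Measure (EuclideanSpace ℝ (Fin n)))]
  simp

/-- Writing -H - z = -(H - (-z)) reduces the second component to the scalar operator at -z; the rays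
are symmetric under z ↦ -z. -/
theorem shift_freeHamiltonian (z : ℂ) (u₁ u₂ : sobolevH2 n) :
    shift (freeHamiltonian n μ) z ⟨((u₁ : L2 n), (u₂ : L2 n)), ⟨u₁.2, u₂.2⟩⟩ =
      (scalarH n μ u₁ - z • (u₁ : L2 n), -(scalarH n μ u₂ - (-z) • (u₂ : L2 n))) := by
  have h : shift (freeHamiltonian n μ) z ⟨((u₁ : L2 n), (u₂ : L2 n)), ⟨u₁.2, u₂.2⟩⟩ =
      (scalarH n μ u₁ + mulL2 (fun _ => 0) MemLp.zero' (u₁ : L2 n) -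
          mulL2 (fun _ => 0) MemLp.zero' (u₂ : L2 n) - z • (u₁ : L2 n),
        mulL2 (fun _ => 0) MemLp.zero' (u₁ : L2 n) -
          (scalarH n μ u₂ + mulL2 (fun _ => 0) MemLp.zero' (u₂ : L2 n)) - z • (u₂ : L2 n)) := rfl
  rw [h, mulL2_zero]
  refine Prod.ext ?_ ?_
  · simp
  · simp only [LinearMap.zero_apply, add_zero, zero_sub]
    module

theorem shift_matrixHamiltonian (hU : MemLp U ∞ volume) (hW : MemLp W ∞ volume) (z : ℂ)
    (u : (freeHamiltonian n μ).domain) :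
    shift (matrixHamiltonian n μ U W hU hW) z u =
      shift (freeHamiltonian n μ) z u + potentialCLM hU hW u := by
  obtain ⟨⟨u₁, u₂⟩, h₁, h₂⟩ := u
  have h : shift (matrixHamiltonian n μ U W hU hW) z ⟨(u₁, u₂), ⟨h₁, h₂⟩⟩ =
      (scalarH n μ ⟨u₁, h₁⟩ + mulL2 U hU u₁ - mulL2 W hW u₂ - z • u₁,
        mulL2 W hW u₁ - (scalarH n μ ⟨u₂, h₂⟩ + mulL2 U hU u₂) - z • u₂) := rfl
  have h' : potentialCLM hU hW (u₁, u₂) =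
      (mulL2 U hU u₁ - mulL2 W hW u₂, mulL2 W hW u₁ - mulL2 U hU u₂) := by
    simp only [mulL2_eq_mulCLM]
    rfl
  refine h.trans ?_
  change _ = shift (freeHamiltonian n μ) z ⟨(u₁, u₂), ⟨h₁, h₂⟩⟩ + potentialCLM hU hW (u₁, u₂)
  rw [h', shift_freeHamiltonian z ⟨u₁, h₁⟩ ⟨u₂, h₂⟩]
  refine Prod.ext ?_ ?_
  · simp only [Prod.mk_add_mk]
    abel
  · simp only [Prod.mk_add_mk]
    module

theorem ne_of_notMem_spectralRays {z : ℂ} (hz : z ∉ spectralRays μ) (t : ℝ) (ht : t ≤ -μ) :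
    (t : ℂ) ≠ z :=
  fun h => hz ⟨t, Or.inl ht, h⟩

theorem ne_neg_of_notMem_spectralRays {z : ℂ} (hz : z ∉ spectralRays μ) (t : ℝ) (ht : t ≤ -μ) :
    (t : ℂ) ≠ -z :=
  fun h => hz ⟨-t, Or.inr (by simp only [Set.mem_Ici]; linarith), by simp [h]⟩

/-- The resolvent of the free Hamiltonian. -/
def freeResolvent (n : ℕ) (μ : ℝ) {z : ℂ} (hz : z ∉ spectralRays μ) :
    L2 n × L2 n →L[ℂ] L2 n × L2 n :=
  (scalarResolvent n μ (ne_of_notMem_spectralRays hz)).prodMap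
    (-scalarResolvent n μ (ne_neg_of_notMem_spectralRays hz))

theorem isResolventAt_freeResolvent {z : ℂ} (hz : z ∉ spectralRays μ) :
    IsResolventAt (freeHamiltonian n μ) z (freeResolvent n μ hz) := by
  constructor
  · rintro ⟨f₁, f₂⟩
    obtain ⟨h₁, e₁⟩ := scalarH_scalarResolvent (ne_of_notMem_spectralRays hz) f₁
    obtain ⟨h₂, e₂⟩ := scalarH_scalarResolvent (ne_neg_of_notMem_spectralRays hz) (-f₂)
    have h : freeResolvent n μ hz (f₁, f₂) =
        (scalarResolvent n μ (ne_of_notMem_spectralRays hz) f₁,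
          scalarResolvent n μ (ne_neg_of_notMem_spectralRays hz) (-f₂)) :=
      Prod.ext rfl (map_neg (scalarResolvent n μ (ne_neg_of_notMem_spectralRays hz)) f₂).symm
    simp only [h]
    refine ⟨⟨h₁, h₂⟩, ?_⟩
    refine (shift_freeHamiltonian z ⟨_, h₁⟩ ⟨_, h₂⟩).trans ?_
    rw [e₁, e₂, neg_neg]
  · rintro ⟨⟨u₁, u₂⟩, h₁, h₂⟩
    have e₁ := scalarResolvent_scalarH (ne_of_notMem_spectralRays hz) ⟨u₁, h₁⟩
    have e₂ := scalarResolvent_scalarH (ne_neg_of_notMem_spectralRays hz) ⟨u₂, h₂⟩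
    rw [shift_freeHamiltonian z ⟨u₁, h₁⟩ ⟨u₂, h₂⟩]
    refine Prod.ext e₁ ?_
    change -(scalarResolvent n μ (ne_neg_of_notMem_spectralRays hz) (-_)) = u₂
    rw [map_neg, neg_neg, e₂]

theorem norm_freeResolvent_le {z : ℂ} (hz : z ∉ spectralRays μ) (h0 : z.im ≠ 0) :
    ‖freeResolvent n μ hz‖ ≤ |z.im|⁻¹ := by
  have h1 := norm_scalarResolvent_le (n := n) (ne_of_notMem_spectralRays hz) h0
  have h2 := norm_scalarResolvent_le (n := n) (ne_neg_of_notMem_spectralRays hz) (by simpa using h0)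
  rw [Complex.neg_im, abs_neg] at h2
  refine ContinuousLinearMap.opNorm_le_bound _ (by positivity) fun f => ?_
  rw [Prod.norm_def]
  refine max_le ?_ ?_
  · refine (ContinuousLinearMap.le_of_opNorm_le _ h1 f.1).trans ?_
    gcongr
    exact norm_fst_le f
  · change ‖-(scalarResolvent n μ (ne_neg_of_notMem_spectralRays hz) f.2)‖ ≤ _
    rw [norm_neg]
    refine (ContinuousLinearMap.le_of_opNorm_le _ h2 f.2).trans ?_
    gcongr
    exact norm_snd_le f

theorem not_isEigenvalue_freeHamiltonian (hn : 0 < n) (z : ℂ) :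
    ¬ IsEigenvalue (freeHamiltonian n μ) z := by
  rintro ⟨⟨⟨u₁, u₂⟩, h₁, h₂⟩, hu, h⟩
  have h0 : shift (freeHamiltonian n μ) z ⟨(u₁, u₂), ⟨h₁, h₂⟩⟩ = 0 := sub_eq_zero.mpr h
  rw [shift_freeHamiltonian z ⟨u₁, h₁⟩ ⟨u₂, h₂⟩] at h0
  have e₁ := eq_zero_of_scalarH_eq_smul hn (sub_eq_zero.mp (congrArg Prod.fst h0))
  have e₂ := eq_zero_of_scalarH_eq_smul hn
    (sub_eq_zero.mp (neg_eq_zero.mp (congrArg Prod.snd h0)))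
  exact hu (Subtype.ext (Prod.ext (congrArg Subtype.val e₁) (congrArg Subtype.val e₂)))

/-- A resolvent R would force ‖u‖ ≤ ‖R‖‖(A₀ - t)u‖, contradicted by an approximate eigenvector
placed in the first component for t ≤ -μ and in the second for t ≥ μ. -/
theorem spectralRays_subset_spectrum_freeHamiltonian (hn : 0 < n) :
    spectralRays μ ⊆ spectrum (freeHamiltonian n μ) := by
  rintro _ ⟨t, ht, rfl⟩ ⟨R, hR⟩
  -- The tolerance (‖R‖ + 1)⁻¹ makes the estimate strict and remains meaningful when R = 0.
  have hpos : 0 < ‖R‖ + 1 := by positivity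
  have key : ∀ (u : (freeHamiltonian n μ).domain) (c : ℝ), c = ‖(u : L2 n × L2 n)‖ → 0 < c →
      ¬ ‖shift (freeHamiltonian n μ) t u‖ ≤ (‖R‖ + 1)⁻¹ * c := by
    intro u c hc hc0 hle
    have h1 := R.le_opNorm (shift (freeHamiltonian n μ) t u)
    rw [hR.2, ← hc] at h1
    have h2 : ‖R‖ * ‖shift (freeHamiltonian n μ) t u‖ ≤ ‖R‖ * ((‖R‖ + 1)⁻¹ * c) := by gcongr
    have h3 : ‖R‖ * ((‖R‖ + 1)⁻¹ * c) < c := by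
      rw [← mul_assoc, ← div_eq_mul_inv]
      refine mul_lt_of_lt_one_left hc0 ?_
      rw [div_lt_one hpos]
      linarith
    linarith
  have hscalar : scalarH n μ 0 = 0 := map_zero _
  rcases ht with ht | ht
  · obtain ⟨u, hu, hle⟩ := exists_norm_scalarH_sub_le hn ht (inv_pos.mpr hpos)
    refine key ⟨((u : L2 n), ((0 : sobolevH2 n) : L2 n)), ⟨u.2, (0 : sobolevH2 n).2⟩⟩ ‖(u : L2 n)‖
      (by simp) (norm_pos_iff.mpr fun h => hu (Subtype.ext h)) ?_
    rw [shift_freeHamiltonian, hscalar]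
    simpa using hle
  · obtain ⟨u, hu, hle⟩ := exists_norm_scalarH_sub_le hn (neg_le_neg ht) (inv_pos.mpr hpos)
    refine key ⟨(((0 : sobolevH2 n) : L2 n), (u : L2 n)), ⟨(0 : sobolevH2 n).2, u.2⟩⟩ ‖(u : L2 n)‖
      (by simp) (norm_pos_iff.mpr fun h => hu (Subtype.ext h)) ?_
    rw [shift_freeHamiltonian, hscalar, ← Complex.ofReal_neg, Submodule.coe_zero, smul_zero,
      sub_zero, Prod.norm_mk, norm_zero, norm_neg]
    exact max_le (by positivity) hle

theorem mulCLM_comp_scalarResolvent_mem {V : EuclideanSpace ℝ (Fin n) → ℝ} (hV : MemLp V ∞ volume)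
    (hV0 : Tendsto V (cocompact (EuclideanSpace ℝ (Fin n)) ⊓ ae volume) (𝓝 0)) {ζ : ℂ}
    (hζ : ∀ t : ℝ, t ≤ -μ → (t : ℂ) ≠ ζ) :
    mulCLM (fun x => (V x : ℂ)) hV.ofReal ∘L scalarResolvent n μ hζ ∈
      approximableOperators (L2 n) (L2 n) := by
  have h0 : Tendsto (fun x => (V x : ℂ))
      (cocompact (EuclideanSpace ℝ (Fin n)) ⊓ ae volume) (𝓝 0) := by
    have h := (Complex.continuous_ofReal.tendsto 0).comp hV0
    rwa [Complex.ofReal_zero] at h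
  have h := comp_mem_approximableOperators_right
    (mulCLM_comp_fourierMultiplier_mem hV.ofReal (memLp_resolventSymbol hζ) h0
      (tendsto_resolventSymbol n μ ζ)) (fourierL2 n : L2 n →L[ℂ] L2 n)
  rw [ContinuousLinearMap.comp_assoc, ContinuousLinearMap.comp_assoc] at h
  exact h

theorem potentialCLM_comp_freeResolvent_mem (hU : MemLp U ∞ volume) (hW : MemLp W ∞ volume)
    (hU0 : Tendsto U (cocompact (EuclideanSpace ℝ (Fin n)) ⊓ ae volume) (𝓝 0))
    (hW0 : Tendsto W (cocompact (EuclideanSpace ℝ (Fin n)) ⊓ ae volume) (𝓝 0)) {z : ℂ}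
    (hz : z ∉ spectralRays μ) :
    potentialCLM hU hW ∘L freeResolvent n μ hz ∈
      approximableOperators (L2 n × L2 n) (L2 n × L2 n) :=
  blockOperator_comp_prodMap_mem
    (mulCLM_comp_scalarResolvent_mem hU hU0 _) (mulCLM_comp_scalarResolvent_mem hW hW0 _)
    (mulCLM_comp_scalarResolvent_mem hU hU0 _) (mulCLM_comp_scalarResolvent_mem hW hW0 _)

/-- The resolvent of a bounded perturbation `B = A + V`. -/
theorem isResolventAt_of_shift_eq_add {X : Type*} [NormedAddCommGroup X] [NormedSpace ℂ X]
    {A B : X →ₗ.[ℂ] X} {V S : X →L[ℂ] X} {z : ℂ} (hdom : B.domain = A.domain)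
    (hV : ∀ u (hB : u ∈ B.domain) (hA : u ∈ A.domain),
      shift B z ⟨u, hB⟩ = shift A z ⟨u, hA⟩ + V u)
    (hS : IsResolventAt A z S) (hu : IsUnit (1 + V * S)) :
    IsResolventAt B z (S * Ring.inverse (1 + V * S)) := by
  constructor
  · intro f
    have hg : (1 + V * S) (Ring.inverse (1 + V * S) f) = f :=
      congrArg (fun C : X →L[ℂ] X => C f) (Ring.mul_inverse_cancel _ hu)
    obtain ⟨h, hSg⟩ := hS.1 (Ring.inverse (1 + V * S) f)
    refine ⟨hdom.symm ▸ h, ?_⟩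
    refine (hV _ _ h).trans ?_
    rw [hSg]
    exact hg
  · rintro ⟨u, hB⟩
    have hA : u ∈ A.domain := hdom ▸ hB
    have hSu : S (shift A z ⟨u, hA⟩) = u := hS.2 ⟨u, hA⟩
    have h1 : (1 + V * S) (shift A z ⟨u, hA⟩) = shift A z ⟨u, hA⟩ + V u := by
      exact congrArg (fun v => shift A z ⟨u, hA⟩ + V v) hSu
    have h2 : Ring.inverse (1 + V * S) ((1 + V * S) (shift A z ⟨u, hA⟩)) = shift A z ⟨u, hA⟩ :=
      congrArg (fun C : X →L[ℂ] X => C (shift A z ⟨u, hA⟩)) (Ring.inverse_mul_cancel _ hu)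
    rw [hV u hB hA, ← h1]
    change S (Ring.inverse (1 + V * S) ((1 + V * S) (shift A z ⟨u, hA⟩))) = u
    rw [h2, hSu]

/-- This is the second resolvent identity S = T + TVS with T = S(1 + VS)⁻¹, inserted into the
pencil. -/
theorem pencil_mul_inverse {X : Type*} [NormedAddCommGroup X] [NormedSpace ℂ X]
    {V S : X →L[ℂ] X} (hu : IsUnit (1 + V * S)) (z w : ℂ) :
    pencil (S * Ring.inverse (1 + V * S)) z w =
      pencil S z w + (w - z) • (S * Ring.inverse (1 + V * S) * (V * S)) := by
  have h : S = S * Ring.inverse (1 + V * S) + S * Ring.inverse (1 + V * S) * (V * S) := by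
    calc S = S * (Ring.inverse (1 + V * S) * (1 + V * S)) := by
          rw [Ring.inverse_mul_cancel _ hu, mul_one]
      _ = _ := by rw [← mul_assoc, mul_add, mul_one]
  have h' : pencil S z w = 1 - (w - z) • S := rfl
  rw [h', pencil]
  conv_rhs =>
    enter [1, 2, 2]
    rw [h]
  rw [smul_add]
  abel

theorem exists_isResolventAt_matrixHamiltonian (hU : MemLp U ∞ volume) (hW : MemLp W ∞ volume)
    (hU0 : Tendsto U (cocompact (EuclideanSpace ℝ (Fin n)) ⊓ ae volume) (𝓝 0))
    (hW0 : Tendsto W (cocompact (EuclideanSpace ℝ (Fin n)) ⊓ ae volume) (𝓝 0)) :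
    ∃ z₀ ∉ spectralRays μ, ∃ S T : L2 n × L2 n →L[ℂ] L2 n × L2 n,
      ∃ K ∈ approximableOperators (L2 n × L2 n) (L2 n × L2 n),
      IsResolventAt (freeHamiltonian n μ) z₀ S ∧
      IsResolventAt (matrixHamiltonian n μ U W hU hW) z₀ T ∧
      ∀ w, pencil T z₀ w = pencil S z₀ w + (w - z₀) • K := by
  obtain ⟨V, hV⟩ : ∃ V, V = potentialCLM hU hW := ⟨_, rfl⟩
  have hpos : 0 < ‖V‖ + 1 := by positivity
  -- At this height ‖VS‖ ≤ ‖V‖/(‖V‖ + 1) < 1, so 1 + VS is inverted by a Neumann series.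
  obtain ⟨z₀, him⟩ : ∃ z₀ : ℂ, z₀.im = ‖V‖ + 1 := ⟨⟨0, ‖V‖ + 1⟩, rfl⟩
  have hz₀ : z₀ ∉ spectralRays μ := by
    rintro ⟨t, -, h⟩
    have := congrArg Complex.im h
    rw [him, Complex.ofReal_im] at this
    linarith
  obtain ⟨S, hS⟩ : ∃ S, S = freeResolvent n μ hz₀ := ⟨_, rfl⟩
  have hSres : IsResolventAt (freeHamiltonian n μ) z₀ S := by
    rw [hS]
    exact isResolventAt_freeResolvent hz₀
  have hVS : V * S ∈ approximableOperators (L2 n × L2 n) (L2 n × L2 n) := by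
    rw [hV, hS]
    exact potentialCLM_comp_freeResolvent_mem hU hW hU0 hW0 hz₀
  have hunit : IsUnit (1 + V * S) := by
    have hnorm : ‖-(V * S)‖ < 1 := by
      have h1 := norm_freeResolvent_le (n := n) hz₀ (by rw [him]; exact hpos.ne')
      rw [him, abs_of_pos hpos, ← hS] at h1
      rw [norm_neg]
      calc ‖V * S‖ ≤ ‖V‖ * ‖S‖ := norm_mul_le _ _
        _ ≤ ‖V‖ * (‖V‖ + 1)⁻¹ := by gcongr
        _ < 1 := by
          rw [← div_eq_mul_inv, div_lt_one hpos]
          linarith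
    have h := isUnit_one_sub_of_norm_lt_one hnorm
    rwa [sub_neg_eq_add] at h
  refine ⟨z₀, hz₀, S, S * Ring.inverse (1 + V * S), S * Ring.inverse (1 + V * S) * (V * S),
    comp_mem_approximableOperators_left _ hVS, hSres, ?_, pencil_mul_inverse hunit z₀⟩
  refine isResolventAt_of_shift_eq_add (A := freeHamiltonian n μ)
    (B := matrixHamiltonian n μ U W hU hW) rfl (fun u _ hu => ?_) hSres hunit
  rw [hV]
  exact shift_matrixHamiltonian hU hW z₀ ⟨u, hu⟩

/-- The complement is star-shaped about 0: dividing a point of a ray by some a in (0, 1] only moves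
it farther out on that ray. -/
theorem isPreconnected_compl_spectralRays (hμ : 0 < μ) : IsPreconnected (spectralRays μ)ᶜ := by
  have h0 : (0 : ℂ) ∈ (spectralRays μ)ᶜ := by
    rintro ⟨t, ht, h⟩
    have h' : t = 0 := Complex.ofReal_eq_zero.mp h
    rcases ht with ht | ht
    · have : t ≤ -μ := ht
      linarith
    · have : μ ≤ t := ht
      linarith
  have hstar : StarConvex ℝ 0 (spectralRays μ)ᶜ := by
    refine starConvex_zero_iff.mpr fun z hz a ha0 ha1 => ?_
    rintro ⟨t, ht, h⟩
    have ha : 0 < a := by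
      refine lt_of_le_of_ne ha0 fun h' => h0 ⟨t, ht, ?_⟩
      rw [h, ← h', zero_smul]
    refine hz ⟨a⁻¹ * t, ?_, ?_⟩
    · rcases ht with ht | ht
      · left
        have : t ≤ -μ := ht
        change a⁻¹ * t ≤ -μ
        rw [inv_mul_le_iff₀ ha]
        nlinarith
      · right
        have : μ ≤ t := ht
        change μ ≤ a⁻¹ * t
        rw [le_inv_mul_iff₀ ha]
        nlinarith
    · simp only at h
      have : (a : ℂ) ≠ 0 := by exact_mod_cast ha.ne'
      simp only [Complex.ofReal_mul, Complex.ofReal_inv, h, Complex.real_smul]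
      field_simp
  exact (hstar.isPathConnected h0).isConnected.isPreconnected

/-- Moving outward along the ray by exactly r gives a second spectral point in the closed ball of
radius r, so no point of a ray is isolated. -/
theorem notMem_discreteSpectrum_of_mem_spectralRays {X : Type*} [NormedAddCommGroup X]
    [NormedSpace ℂ X] {A : X →ₗ.[ℂ] X} (hA : spectralRays μ ⊆ spectrum A) {z : ℂ}
    (hz : z ∈ spectralRays μ) : z ∉ discreteSpectrum A := by
  rintro ⟨-, r, hr, hball, -⟩
  obtain ⟨t, ht, rfl⟩ := hz
  obtain ⟨s, hs, hst⟩ : ∃ s : ℝ, s ∈ Set.Iic (-μ) ∪ Set.Ici μ ∧ |s - t| = r := by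
    rcases ht with ht | ht
    · refine ⟨t - r, Or.inl ?_, by simp [abs_of_pos hr]⟩
      have : t ≤ -μ := ht
      change t - r ≤ -μ
      linarith
    · refine ⟨t + r, Or.inr ?_, by simp [abs_of_pos hr]⟩
      have : μ ≤ t := ht
      change μ ≤ t + r
      linarith
  have hmem : (s : ℂ) ∈ Metric.closedBall (t : ℂ) r ∩ spectrum A := by
    refine ⟨?_, hA ⟨s, hs, rfl⟩⟩
    rw [mem_closedBall_iff_norm, ← Complex.ofReal_sub, Complex.norm_real, Real.norm_eq_abs, hst]
  rw [hball, Set.mem_singleton_iff, Complex.ofReal_inj] at hmem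
  rw [hmem, sub_self, abs_zero] at hst
  exact hr.ne hst

end Matrix

end

theorem mainTheorem8 (n : ℕ) (hn : 0 < n) (μ : ℝ) (hμ : 0 < μ)
    (U W : EuclideanSpace ℝ (Fin n) → ℝ)
    (hU : MemLp U ∞ volume) (hW : MemLp W ∞ volume)
    (hU0 : Tendsto U (cocompact (EuclideanSpace ℝ (Fin n)) ⊓ ae volume) (𝓝 0))
    (hW0 : Tendsto W (cocompact (EuclideanSpace ℝ (Fin n)) ⊓ ae volume) (𝓝 0)) :
    -- the resolvent is defined off a discrete subset of `Ω` and is meromorphic in `Ω`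
    (∀ z ∈ (spectralRays μ)ᶜ,
      ∀ᶠ w in 𝓝[≠] z, w ∈ UnboundedOp.resolventSet (matrixHamiltonian n μ U W hU hW)) ∧
    MeromorphicOn (UnboundedOp.resolvent (matrixHamiltonian n μ U W hU hW)) (spectralRays μ)ᶜ ∧
    -- its poles are the points of the spectrum in `Ω`, and these are the eigenvalues in `Ω`
    (∀ z ∈ (spectralRays μ)ᶜ,
      (meromorphicOrderAt (UnboundedOp.resolvent (matrixHamiltonian n μ U W hU hW)) z < 0 ↔
        z ∈ UnboundedOp.spectrum (matrixHamiltonian n μ U W hU hW)) ∧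
      (meromorphicOrderAt (UnboundedOp.resolvent (matrixHamiltonian n μ U W hU hW)) z < 0 ↔
        UnboundedOp.IsEigenvalue (matrixHamiltonian n μ U W hU hW) z)) ∧
    -- the eigenvalues in `Ω` have finite (algebraic, hence geometric) multiplicity
    (∀ z ∈ (spectralRays μ)ᶜ,
      FiniteDimensional ℂ (UnboundedOp.rootSpace (matrixHamiltonian n μ U W hU hW) z)) ∧
    -- `Ran(A - z)` is closed
    (∀ z ∈ (spectralRays μ)ᶜ,
      IsClosed (Set.range (UnboundedOp.shift (matrixHamiltonian n μ U W hU hW) z))) ∧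
    UnboundedOp.essentialSpectrum (matrixHamiltonian n μ U W hU hW) = spectralRays μ := by
  have hΩ := isPreconnected_compl_spectralRays hμ
  obtain ⟨z₀, hz₀, S, T, K, hK, hSres, hTres, hpencil⟩ :=
    exists_isResolventAt_matrixHamiltonian (μ := μ) hU hW hU0 hW0
  have hfin : ∀ w ∈ (spectralRays μ)ᶜ, IsUnitAddFiniteRank (UnboundedOp.pencil T z₀ w) := by
    intro w hw
    rw [hpencil]
    exact (hSres.isUnit_pencil (isResolventAt_freeResolvent hw)).isUnitAddFiniteRank_add
      (Submodule.smul_mem _ _ hK)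
  -- The perturbation argument is run backwards: L_S(z) = L_T(z) - (z - z₀)K would be invertible
  -- plus finite rank, and it is injective because A₀ has no eigenvalues.
  have hrays : spectralRays μ ⊆ UnboundedOp.spectrum (matrixHamiltonian n μ U W hU hW) := by
    intro z hz hzres
    have hu := (hTres.mem_resolventSet_iff z).mp hzres
    have hS' : IsUnitAddFiniteRank (UnboundedOp.pencil S z₀ z) := by
      have h1 := hu.isUnitAddFiniteRank_add (neg_mem (Submodule.smul_mem _ (z - z₀) hK))
      rwa [hpencil, add_neg_cancel_right] at h1
    have hinj : Function.Injective (UnboundedOp.pencil S z₀ z) := by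
      by_contra h
      exact not_isEigenvalue_freeHamiltonian hn z ((hSres.isEigenvalue_iff z).mpr h)
    exact spectralRays_subset_spectrum_freeHamiltonian hn hz
      ((hSres.mem_resolventSet_iff z).mpr (hS'.isUnit_of_injective hinj))
  refine ⟨fun z hz => UnboundedOp.eventually_mem_resolventSet hTres hΩ hz₀ hfin hz,
    UnboundedOp.meromorphicOn_resolvent hTres hΩ hz₀ hfin, fun z hz => ?_,
    fun z hz => UnboundedOp.finiteDimensional_rootSpace hTres hΩ hz₀ hfin hz, fun z hz => ?_, ?_⟩
  · have h1 := UnboundedOp.meromorphicOrderAt_resolvent_neg_iff hTres hΩ hz₀ hfin hz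
    exact ⟨h1, h1.trans (UnboundedOp.mem_spectrum_iff_isEigenvalue hTres (hfin z hz))⟩
  · rw [hTres.range_shift]
    exact (hfin z hz).isClosed_range
  · refine Set.Subset.antisymm (fun z hz => ?_) fun z hz =>
      ⟨hrays hz, notMem_discreteSpectrum_of_mem_spectralRays hrays hz⟩
    by_contra hzr
    exact hz.2 (UnboundedOp.mem_discreteSpectrum hTres hΩ hz₀ hfin hzr hz.1)
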